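/- **Setting.** Let $X=(X_t)_{t\ge 0}$, with laws $(\mathbb P_x)_{x\in S}$, be a Hunt process with infinite lifetime taking values in a set $S\subseteq\mathbb R$: it is strong Markov, quasi-left-continuous, and has right-continuous paths which almost surely have left limits in $S$. Let $\mathcal M$ be the set of $[0,\infty]$-valued stopping times of the natural filtration of $X$ (with its usual augmentation). Let $\beta>0$, and let $T$ be exponentially distributed with mean $1/\beta$ and independent of $X$ under every $\mathbb P_x$. Write $M_T=\sup_{0\le t\le T}X_t$ and $I_T=\inf_{0\le t\le T}X_t$. Let $G:S\to[0,\infty)$ be lower semicontinuous with $\mathbb E_x\big(\sup_{t\ge0}e^{-\beta t}G(X_t)\big)<\infty$ for all $x\in S$, and let $$V(x)=\sup_{\tau\in\mathcal M}\mathbb E_x\big(e^{-\beta\tau}G(X_\tau)\big),\qquad e^{-\beta\tau}G(X_\tau):=\limsup_{t\to\infty}e^{-\beta t}G(X_t)\ \text{ on }\{\tau=\infty\}.$$ **Theorem (two-sided case).** Assume that there are a lower semicontinuous function $\hat f:S\to\mathbb R$, points $x_*\le x^*$ in $S$, and a set $J\subseteq S$ with $S\cap(x_*,x^*)\subseteq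 J\subseteq S\cap[x_*,x^*]$ (so each of the two thresholds may or may not be included in $J$) such that (a) (i) $\hat f\le 0$ on $J$; (ii) $\hat f\ge 0$ on $S\setminus J$, and $\hat f$ is non-increasing on $\{x\in S\setminus J: x\le x_*\}$ and non-decreasing on $\{x\in S\setminus J: x\ge x^*\}$; (b) (i) $\mathbb E_x\big(\sup_{0\le t\le T}\hat f(X_t)\big)=G(x)$ for all $x\in S\setminus(x_*,x^*)$; (ii) $\mathbb E_x\big(\sup_{0\le t\le T}\hat f(X_t)\big)\ge G(x)$ for all $x\in S\cap(x_*,x^*)$. Then, for every $x\in S$, one has $I_T,M_T\in S$ $\mathbb P_x$-almost surely and $$V(x)=\mathbb E_x\Big(\sup_{0\le t\le T}\hat f(X_t)1_{\{X_t\notin J\}}\Big)=\mathbb E_x\Big(\hat f(I_T)1_{\{I_T\le x_*\}}\vee\hat f(M_T)1_{\{M_T\ge x^*\}}\vee 0\Big).$$ If $\hat f(x_*)\ge0$ or $\hat f(x^*)\ge 0$ or $\mathbb P_x(I_T=x_*,\,M_T=x^*)=0$, then also $$V(x)=\mathbb E_x\Big(\hat f(I_T)1_{\{I_T\le x_*\}}\vee\hat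 f(M_T)1_{\{M_T\ge x^*\}}\Big).$$ Moreover, $\tau^*:=\inf\{t\ge0: X_t\notin J\}$ is a stopping time in $\mathcal M$ and is optimal: $V(x)=\mathbb E_x\big(e^{-\beta\tau^*}G(X_{\tau^*})\big)$ for every $x\in S$. -/

import Mathlib

open Set Filter Topology MeasureTheory ProbabilityTheory
open scoped NNReal ENNReal

namespace HuntStop

noncomputable section

variable {S : Set ℝ} {Ω : Type*}

/-- The raw natural filtration `σ(X_s, s ≤ t)`. -/
@[reducible] def rawFiltration (X : ℝ≥0 → Ω → S) (t : ℝ≥0) : MeasurableSpace Ω :=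
  ⨆ s ∈ Iic t, MeasurableSpace.comap (X s) inferInstance

/-- The σ-algebra `σ(X_s, s ≥ 0)`. -/
@[reducible] def rawSigma (X : ℝ≥0 → Ω → S) : MeasurableSpace Ω :=
  ⨆ s, MeasurableSpace.comap (X s) inferInstance

/-- Membership `A ∈ 𝓕_t` in the natural filtration of a Markov process, taken, as is standard
for Hunt processes, with its usual augmentation: for every initial distribution `μ` on `S`, the
event `A` differs from an event of `⋂_{s > t} σ(X_r, r ≤ s)` at most on a null set of
`P_μ = ∫ P_x μ(dx)`. -/
def InFiltration [MeasurableSpace Ω] (X : ℝ≥0 → Ω → S) (P : S → Measure Ω)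
    (t : ℝ≥0) (A : Set Ω) : Prop :=
  ∀ μ : Measure S, IsProbabilityMeasure μ →
    ∃ B N : Set Ω, MeasurableSet[⨅ s ∈ Ioi t, rawFiltration X s] B ∧
      MeasurableSet[rawSigma X] N ∧ symmDiff A B ⊆ N ∧ ∀ᵐ x ∂μ, P x N = 0

/-- Stopping times with values in `[0, ∞]` with respect to the natural filtration. -/
def IsStopping [MeasurableSpace Ω] (X : ℝ≥0 → Ω → S) (P : S → Measure Ω)
    (τ : Ω → ℝ≥0∞) : Prop :=
  ∀ t : ℝ≥0, InFiltration X P t {ω | τ ω ≤ t}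

/-- Membership `A ∈ 𝓕_τ` in the σ-algebra of the past of the stopping time `τ`. -/
def InPast [MeasurableSpace Ω] (X : ℝ≥0 → Ω → S) (P : S → Measure Ω)
    (τ : Ω → ℝ≥0∞) (A : Set Ω) : Prop :=
  ∀ t : ℝ≥0, InFiltration X P t (A ∩ {ω | τ ω ≤ t})

/-- The position `X_τ`; only meaningful (and only used) on `{τ < ∞}`. -/
def posAt (X : ℝ≥0 → Ω → S) (τ : Ω → ℝ≥0∞) (ω : Ω) : S := X (τ ω).toNNReal ω

/-- `(X, (P_x)_{x ∈ S})` is a Hunt process with state space `S ⊆ ℝ` and infinite lifetime. -/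
structure IsHuntProcess [MeasurableSpace Ω] (X : ℝ≥0 → Ω → S) (P : S → Measure Ω) : Prop where
  prob : ∀ x, IsProbabilityMeasure (P x)
  measurable_pos : ∀ t, Measurable (X t)
  measurable_law : ∀ B : Set (ℝ≥0 → S), MeasurableSet B →
    Measurable fun x => P x {ω | (fun t => X t ω) ∈ B}
  start : ∀ x, ∀ᵐ ω ∂P x, X 0 ω = x
  right_cont : ∀ ω t, ContinuousWithinAt (fun s => X s ω) (Ici t) t
  left_lim : ∀ x, ∀ᵐ ω ∂P x, ∀ t : ℝ≥0, 0 < t →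
    ∃ l : S, Tendsto (fun s => X s ω) (𝓝[<] t) (𝓝 l)
  /-- For a stopping time `τ`, given `𝓕_τ` and on `{τ < ∞}`, the process `(X_{τ+s})_{s ≥ 0}` has
  the law of `X` under `P_{X_τ}`. -/
  strong_markov : ∀ τ : Ω → ℝ≥0∞, IsStopping X P τ → ∀ A : Set Ω, InPast X P τ A →
    ∀ B : Set (ℝ≥0 → S), MeasurableSet B → ∀ x,
      P x {ω | ω ∈ A ∧ τ ω < ⊤ ∧ (fun s => X ((τ ω).toNNReal + s) ω) ∈ B} =
        ∫⁻ ω in {ω | ω ∈ A ∧ τ ω < ⊤}, P (posAt X τ ω) {ω' | (fun s => X s ω') ∈ B} ∂P x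
  quasi_left_cont : ∀ τ : ℕ → Ω → ℝ≥0∞, (∀ n, IsStopping X P (τ n)) →
    (∀ ω, Monotone fun n => τ n ω) → ∀ x, ∀ᵐ ω ∂P x, (⨆ n, τ n ω) < ⊤ →
      Tendsto (fun n => posAt X (τ n) ω) atTop (𝓝 (posAt X (fun ω => ⨆ n, τ n ω) ω))

/-- `T` is, under every `P_x`, exponential with mean `1 / β` and independent of `X`. -/
structure IsIndepExpTime [MeasurableSpace Ω] (X : ℝ≥0 → Ω → S) (P : S → Measure Ω)
    (β : ℝ) (T : Ω → ℝ≥0) : Prop where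
  measurable : Measurable T
  law : ∀ x, (P x).map (fun ω => (T ω : ℝ)) = expMeasure β
  indep : ∀ x, IndepFun (fun ω t => X t ω) T (P x)

/-- The expectation of an extended real random variable, `E Y⁺ - E Y⁻`. -/
def expect [MeasurableSpace Ω] (μ : Measure Ω) (Y : Ω → EReal) : EReal :=
  ((∫⁻ ω, (Y ω).toENNReal ∂μ : ℝ≥0∞) : EReal) - ((∫⁻ ω, (-Y ω).toENNReal ∂μ : ℝ≥0∞) : EReal)

/-- `sup_{0 ≤ t ≤ T} h(X_t)`. -/
def supUpTo (X : ℝ≥0 → Ω → S) (T : Ω → ℝ≥0) (h : S → ℝ) (ω : Ω) : EReal :=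
  ⨆ t ∈ Iic (T ω), ((h (X t ω) : ℝ) : EReal)

/-- The running maximum `M_T = sup_{0 ≤ t ≤ T} X_t`. -/
def runMax (X : ℝ≥0 → Ω → S) (T : Ω → ℝ≥0) (ω : Ω) : ℝ :=
  sSup ((fun t => (X t ω : ℝ)) '' Iic (T ω))

/-- The running minimum `I_T = inf_{0 ≤ t ≤ T} X_t`. -/
def runMin (X : ℝ≥0 → Ω → S) (T : Ω → ℝ≥0) (ω : Ω) : ℝ :=
  sInf ((fun t => (X t ω : ℝ)) '' Iic (T ω))

/-- A function on `S` evaluated at a real number (zero off `S`). -/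
def atReal (f : S → ℝ) : ℝ → ℝ := Function.extend Subtype.val f 0

open Classical in
/-- `f(I_T) 1{I_T ≤ a} ∨ f(M_T) 1{M_T ≥ b}`. -/
def twoSidedMax (X : ℝ≥0 → Ω → S) (T : Ω → ℝ≥0) (f : S → ℝ) (a b : S) (ω : Ω) : ℝ :=
  max (if runMin X T ω ≤ a then atReal f (runMin X T ω) else 0)
    (if (b : ℝ) ≤ runMax X T ω then atReal f (runMax X T ω) else 0)

open Classical in
/-- The discounted reward `e^{-βτ} G(X_τ)` of a nonnegative `G`, which on `{τ = ∞}` is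
`limsup_{t → ∞} e^{-βt} G(X_t)`. -/
def reward (X : ℝ≥0 → Ω → S) (β : ℝ) (G : S → ℝ) (τ : Ω → ℝ≥0∞) (ω : Ω) : ℝ≥0∞ :=
  if τ ω = ⊤ then
    limsup (fun t : ℝ≥0 => ENNReal.ofReal (Real.exp (-β * t) * G (X t ω))) atTop
  else ENNReal.ofReal (Real.exp (-β * (τ ω).toReal) * G (posAt X τ ω))

/-- The value function `V(x) = sup_τ E_x(e^{-βτ} G(X_τ))`, over all stopping times. -/
def value [MeasurableSpace Ω] (X : ℝ≥0 → Ω → S) (P : S → Measure Ω) (β : ℝ) (G : S → ℝ)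
    (x : S) : ℝ≥0∞ :=
  ⨆ (τ : Ω → ℝ≥0∞) (_ : IsStopping X P τ), ∫⁻ ω, reward X β G τ ω ∂P x

/-- `τ` is a stopping time that attains the value function at every starting point. -/
def IsOptimal [MeasurableSpace Ω] (X : ℝ≥0 → Ω → S) (P : S → Measure Ω) (β : ℝ) (G : S → ℝ)
    (τ : Ω → ℝ≥0∞) : Prop :=
  IsStopping X P τ ∧ ∀ x, value X P β G x = ∫⁻ ω, reward X β G τ ω ∂P x

/-- `inf {t ≥ 0 : X_t ∉ J}`. -/
def exitTime (X : ℝ≥0 → Ω → S) (J : Set S) (ω : Ω) : ℝ≥0∞ :=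
  ⨅ (t : ℝ≥0) (_ : X t ω ∉ J), (t : ℝ≥0∞)

end

end HuntStop

open HuntStop

/-!
Write `U x = E_x (sup_{t ≤ T} f(X_t))⁺` and `N x = E_x (sup_{t ≤ T} f(X_t))⁻`. Since `f ≤ 0` on `J`
and `f ≥ 0` off `J`, the positive part of the supremum is the supremum of `f(X_t) 1{X_t ∉ J}`, and
all the representations in the theorem are formulas for `U`. The point is that `V = U`.

*Reduction to path functionals.* The supremum over `t < u` of `f` along a right-continuous path is a
supremum over countably many times, hence a jointly measurable functional of the path and of `u`
(`supBefore`). It is monotone in `u`, so it has countably many jumps, which the exponential time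
almost surely avoids; whether the horizon is included does not matter. By independence `U` and `N`
become expectations of functionals of the path alone (`lintegral_supUpTo`).

*The key identity.* The discount factor `e^{-βτ}` is the probability of `{τ ≤ T}` given the path,
and the exponential law has no memory. With the strong Markov property
(`lintegral_discount_shift`) this gives, for every stopping time `τ`,
`E_x (e^{-βτ} U(X_τ)) = E_x (1{τ ≤ T} (sup_{τ ≤ t ≤ T} f(X_t))⁺)`, and the same identity for `N` with
negative parts. The right-hand side is at most `U x` (`lintegral_discount_expSup_le`).

*Upper bound.* Everywhere `G ≤ U`, so `E_x (e^{-βτ} G(X_τ); τ < ∞) ≤ U x`.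

*Lower bound.* Before the exit time `τ*` from `J` the values `f(X_t)` are nonpositive, so the key
identity at `τ*` is an equality with `U x` (`lintegral_expSup_le_exitTime`). Right after `τ*` the
process visits the complement of `J`, where `f ≥ 0`, so the term with `N` vanishes
(`lintegral_discount_expSup_neg_exitTime`). As `X_{τ*}` is outside the open interval, where
`G = U - N`, the payoff of `τ*` is `U x`; in particular `U x` is finite.

*Never stopping.* Finiteness of `U x` and the upper bound for stopping times `τ ≥ n` give a maximal
inequality showing that `e^{-βt} G(X_t)` tends to `0` almost surely (`ae_limsup_reward_eq_zero`).
Only stopping times with finitely many values are used, because `G` is merely lower semicontinuous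
and its value at a first passage time is not under control.

*The running extrema.* The closure of the range of a càdlàg path over a compact time interval
consists of values and left limits, hence stays in `S`. Monotonicity of `f` outside `J` bounds the
supremum by the values at the extrema, and lower semicontinuity gives the converse
(`max_supUpTo_eq`).

*Measurability of the exit time.* The hitting time of an open set is a stopping time of the
right-continuous filtration; the hitting time of a closed set is the almost sure limit of those of
its neighbourhoods, by quasi-left-continuity (`isStopping_hitTime_of_isClosed`).
-/

namespace HuntStop

section

/-! ### The exponential law on the half-line -/

/-- The exponential law with rate `β` as a measure on `ℝ≥0`, the type in which time is measured. -/
noncomputable def expTime (β : ℝ) : Measure ℝ≥0 := (expMeasure β).map Real.toNNReal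

lemma isProbabilityMeasure_expTime {β : ℝ} (hβ : 0 < β) : IsProbabilityMeasure (expTime β) := by
  have := isProbabilityMeasure_expMeasure hβ
  exact Measure.isProbabilityMeasure_map measurable_real_toNNReal.aemeasurable

lemma lintegral_expTime (β : ℝ) {φ : ℝ≥0 → ℝ≥0∞} (hφ : Measurable φ) :
    ∫⁻ u, φ u ∂expTime β = ∫⁻ x : ℝ, exponentialPDF β x * φ x.toNNReal := by
  rw [expTime, lintegral_map hφ measurable_real_toNNReal, expMeasure, gammaMeasure]
  exact lintegral_withDensity_eq_lintegral_mul _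
    (measurable_exponentialPDFReal β).ennreal_ofReal (hφ.comp measurable_real_toNNReal)

lemma nullSingletonClass_expTime (β : ℝ) : NullSingletonClass (expTime β) := by
  refine ⟨fun s => ?_⟩
  rw [← lintegral_indicator_one (measurableSet_singleton s),
    lintegral_expTime β (measurable_one.indicator (measurableSet_singleton s))]
  refine (lintegral_congr_ae ?_).trans lintegral_zero
  have h0 : ∀ᵐ x : ℝ, x ≠ 0 := by simp [ae_iff]
  have hs : ∀ᵐ x : ℝ, x ≠ (s : ℝ) := by simp [ae_iff]
  filter_upwards [h0, hs] with x hx0 hxs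
  rcases lt_or_gt_of_ne hx0 with h | h
  · simp [exponentialPDF_of_neg h]
  · have : x.toNNReal ≠ s := fun e => hxs (by rw [← e, Real.coe_toNNReal _ h.le])
    simp [this]

/-- The exponential law has no memory. -/
lemma setLIntegral_Ici_expTime {β : ℝ} (s : ℝ≥0) {φ : ℝ≥0 → ℝ≥0∞} (hφ : Measurable φ) :
    ∫⁻ u in Ici s, φ u ∂expTime β
      = ENNReal.ofReal (Real.exp (-β * s)) * ∫⁻ v, φ (s + v) ∂expTime β := by
  have hφs : Measurable fun v => φ (s + v) := hφ.comp (measurable_const_add s)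
  have hm : Measurable fun x : ℝ => exponentialPDF β x * φ (s + x.toNNReal) :=
    (measurable_exponentialPDFReal β).ennreal_ofReal.mul (hφs.comp measurable_real_toNNReal)
  rw [← lintegral_indicator measurableSet_Ici, lintegral_expTime β (hφ.indicator measurableSet_Ici),
    lintegral_expTime β hφs, ← lintegral_const_mul _ hm,
    ← lintegral_add_right_eq_self _ (s : ℝ)]
  refine lintegral_congr fun y => ?_
  rcases lt_or_ge y 0 with hy | hy
  · rw [exponentialPDF_of_neg hy]
    rcases lt_or_ge (y + s) 0 with h | h
    · simp [exponentialPDF_of_neg h]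
    · have : (y + s).toNNReal ∉ Ici s := by
        rw [mem_Ici, not_le, ← NNReal.coe_lt_coe, Real.coe_toNNReal _ h]
        linarith
      simp [this]
  · have e : (y + s).toNNReal = s + y.toNNReal := by
      rw [Real.toNNReal_add hy s.coe_nonneg, Real.toNNReal_coe, add_comm]
    have hm : (y + s).toNNReal ∈ Ici s := by simp [e]
    rw [indicator_of_mem hm, e, exponentialPDF_of_nonneg hy,
      exponentialPDF_of_nonneg (add_nonneg hy s.coe_nonneg), ← mul_assoc,
      ← ENNReal.ofReal_mul (Real.exp_pos _).le]
    congr 2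
    rw [mul_left_comm, ← Real.exp_add]
    ring_nf

/-- The discount factor `e^{-βt}`, read as `0` at `t = ∞`, is the probability that an exponential
time is at least `t`. -/
lemma expTime_tail {β : ℝ} (hβ : 0 < β) (t : ℝ≥0∞) :
    expTime β {s | t ≤ (s : ℝ≥0∞)} =
      if t = ⊤ then 0 else ENNReal.ofReal (Real.exp (-β * t.toReal)) := by
  have := isProbabilityMeasure_expTime hβ
  split_ifs with ht
  · simp [ht]
  · lift t to ℝ≥0 using ht
    have h := setLIntegral_Ici_expTime (β := β) t (φ := fun _ => 1) measurable_const
    simpa [Ici] using h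

/-! ### Suprema along right-continuous paths -/

variable {S : Set ℝ}

/-- A fixed sequence of times that is dense in `[0, ∞)`. -/
noncomputable def denseTime : ℕ → ℝ≥0 := TopologicalSpace.denseSeq ℝ≥0

/-- What holds on a right neighbourhood of `t` holds at members of the dense sequence just
after `t`. -/
lemma exists_denseTime {p : ℝ≥0 → Prop} {t u : ℝ≥0} (htu : t < u) (h : ∀ᶠ s in 𝓝[≥] t, p s) :
    ∃ n, t < denseTime n ∧ denseTime n < u ∧ p (denseTime n) := by
  obtain ⟨v, hv, hvs⟩ := mem_nhdsGE_iff_exists_Ico_subset.1 h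
  obtain ⟨_, ⟨n, rfl⟩, hn⟩ :=
    (TopologicalSpace.denseRange_denseSeq ℝ≥0).exists_between (lt_min htu hv)
  exact ⟨n, hn.1, hn.2.trans_le (min_le_left _ _),
    hvs ⟨hn.1.le, hn.2.trans_le (min_le_right _ _)⟩⟩

/-- `sup_{t < u} f(w_t)`, taken over a countable dense set of times so that it is a measurable
functional on the product space of all paths. -/
noncomputable def supBefore (f : S → ℝ) (w : ℝ≥0 → S) (u : ℝ≥0) : EReal :=
  ⨆ (n : ℕ) (_ : denseTime n < u), ((f (w (denseTime n)) : ℝ) : EReal)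

lemma le_supBefore {f : S → ℝ} (hf : LowerSemicontinuous f) {w : ℝ≥0 → S}
    (hw : ∀ t, ContinuousWithinAt w (Ici t) t) {t u : ℝ≥0} (htu : t < u) :
    ((f (w t) : ℝ) : EReal) ≤ supBefore f w u := by
  by_contra! hlt
  obtain ⟨r, hr, hrt⟩ := EReal.lt_iff_exists_real_btwn.1 hlt
  obtain ⟨n, -, hnu, hn⟩ := exists_denseTime htu
    ((hw t).eventually (hf (w t) r (EReal.coe_lt_coe_iff.1 hrt)))
  have h1 : ((f (w (denseTime n)) : ℝ) : EReal) ≤ supBefore f w u :=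
    le_iSup₂ (f := fun n (_ : denseTime n < u) => ((f (w (denseTime n)) : ℝ) : EReal)) n hnu
  exact absurd (h1.trans_lt hr) (not_lt.2 (EReal.coe_le_coe_iff.2 hn.le))

lemma supBefore_le {f : S → ℝ} {w : ℝ≥0 → S} {u : ℝ≥0} {c : EReal}
    (h : ∀ t < u, ((f (w t) : ℝ) : EReal) ≤ c) : supBefore f w u ≤ c :=
  iSup₂_le fun _ hn => h _ hn

lemma supBefore_mono (f : S → ℝ) (w : ℝ≥0 → S) : Monotone (supBefore f w) := fun _ _ h =>
  iSup_mono fun _ => iSup_mono' fun hn => ⟨hn.trans_le h, le_rfl⟩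

lemma measurable_supBefore {f : S → ℝ} (hf : Measurable f) {α : Type*} [MeasurableSpace α]
    {w : α → ℝ≥0 → S} {u : α → ℝ≥0} (hw : Measurable w) (hu : Measurable u) :
    Measurable fun a => supBefore f (w a) (u a) := by
  classical
  simp only [supBefore, iSup_eq_if]
  refine Measurable.iSup fun n => Measurable.ite ?_ ?_ measurable_const
  · exact measurableSet_lt measurable_const hu
  · exact measurable_coe_real_ereal.comp (hf.comp ((measurable_pi_apply _).comp hw))

/-- The running supremum is monotone in its horizon, hence jumps at countably many horizons only;
an exponential horizon almost surely avoids these. -/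
lemma ae_supBefore_eq_iInf (β : ℝ) (f : S → ℝ) (w : ℝ≥0 → S) :
    ∀ᵐ u ∂expTime β, supBefore f w u = ⨅ n : ℕ, supBefore f w (u + 1 / (n + 1)) := by
  have := nullSingletonClass_expTime β
  have hc := (supBefore_mono f w).countable_not_continuousAt
  filter_upwards [hc.ae_notMem (expTime β)] with u hu
  have hu : ContinuousAt (supBefore f w) u := by simpa using hu
  refine le_antisymm (le_iInf fun n => supBefore_mono f w le_self_add) ?_
  have hlim : Tendsto (fun n : ℕ => u + 1 / ((n : ℝ≥0) + 1)) atTop (𝓝 u) := by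
    simpa using (tendsto_one_div_add_atTop_nhds_zero_nat (𝕜 := ℝ≥0)).const_add u
  exact ge_of_tendsto' (hu.tendsto.comp hlim) fun n => iInf_le _ n

lemma measurableSet_supBefore_eq_iInf {f : S → ℝ} (hf : Measurable f) :
    MeasurableSet {p : (ℝ≥0 → S) × ℝ≥0 |
      supBefore f p.1 p.2 = ⨅ n : ℕ, supBefore f p.1 (p.2 + 1 / (n + 1))} := by
  exact measurableSet_eq_fun (measurable_supBefore hf measurable_fst measurable_snd)
    (Measurable.iInf fun n => measurable_supBefore hf measurable_fst
      (measurable_snd.add_const (1 / ((n : ℝ≥0) + 1))))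

/-- The expectation, over an exponential horizon, of `ψ (sup_{t < T} f(w_t))` along a path `w`. -/
noncomputable def expSup (β : ℝ) (f : S → ℝ) (ψ : EReal → ℝ≥0∞) (w : ℝ≥0 → S) : ℝ≥0∞ :=
  ∫⁻ u, ψ (supBefore f w u) ∂expTime β

lemma measurable_expSup {β : ℝ} (hβ : 0 < β) {f : S → ℝ} (hf : Measurable f) {ψ : EReal → ℝ≥0∞}
    (hψ : Measurable ψ) : Measurable (expSup β f ψ) := by
  have := isProbabilityMeasure_expTime hβ
  have h : Measurable fun p : (ℝ≥0 → S) × ℝ≥0 => ψ (supBefore f p.1 p.2) :=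
    hψ.comp (measurable_supBefore hf measurable_fst measurable_snd)
  exact h.lintegral_prod_right'

/-- By lack of memory, discounting the functional of the path shifted by `t` amounts to restricting
the exponential horizon to be at least `t`. -/
lemma ofReal_exp_mul_expSup_shift {β : ℝ} {f : S → ℝ} (hf : Measurable f)
    {ψ : EReal → ℝ≥0∞} (hψ : Measurable ψ) (w : ℝ≥0 → S) (t : ℝ≥0) :
    ENNReal.ofReal (Real.exp (-β * t)) * expSup β f ψ (fun s => w (t + s)) =
      ∫⁻ u in Ici t, ψ (supBefore f (fun s => w (t + s)) (u - t)) ∂expTime β := by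
  have hm : Measurable fun u : ℝ≥0 => ψ (supBefore f (fun s => w (t + s)) (u - t)) :=
    hψ.comp (measurable_supBefore hf measurable_const (measurable_id.sub_const t))
  rw [setLIntegral_Ici_expTime t hm, expSup]
  simp

lemma continuousWithinAt_shift {w : ℝ≥0 → S} (hw : ∀ t, ContinuousWithinAt w (Ici t) t)
    (s t : ℝ≥0) : ContinuousWithinAt (fun v => w (s + v)) (Ici t) t :=
  (hw (s + t)).comp (continuous_const_add s).continuousWithinAt
    fun _ hv => add_le_add_right (mem_Ici.1 hv) s

/-! ### Ranges of càdlàg paths -/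

/-- If all left limits of a right-continuous path exist in `S`, then along times in a compact
interval any filter that the path clusters at has a cluster point in `S`. -/
lemma exists_mem_neBot_of_cadlag {w : ℝ≥0 → S} (hw : ∀ t, ContinuousWithinAt w (Ici t) t)
    (hl : ∀ t : ℝ≥0, 0 < t → ∃ l : S, Tendsto w (𝓝[<] t) (𝓝 l)) {u : ℝ≥0} {F : Filter ℝ}
    (hF : (comap (fun t => (w t : ℝ)) F ⊓ 𝓟 (Iic u)).NeBot) :
    ∃ l : S, (F ⊓ 𝓝 (l : ℝ)).NeBot := by
  have hK : IsCompact (Iic u) := by rw [← Icc_bot]; exact isCompact_Icc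
  set H := comap (fun t => (w t : ℝ)) F ⊓ 𝓟 (Iic u) with hH
  obtain ⟨t, -, ht⟩ := hK (f := H) inf_le_right
  have key : ∀ (G : Filter ℝ≥0) (l : S), (G ⊓ H).NeBot → Tendsto w G (𝓝 l) →
      ∃ l : S, (F ⊓ 𝓝 (l : ℝ)).NeBot := by
    intro G l hG hlim
    refine ⟨l, Tendsto.neBot (f := fun t => (w t : ℝ)) (x := G ⊓ H) ?_⟩
    refine tendsto_inf.2 ⟨?_, ?_⟩
    · exact (tendsto_comap (f := fun t => (w t : ℝ)) (x := F)).mono_left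
        (inf_le_right.trans inf_le_left)
    · exact ((continuous_subtype_val.tendsto l).comp hlim).mono_left inf_le_left
  rw [ClusterPt, ← nhdsLT_sup_nhdsGE, inf_sup_right, sup_neBot] at ht
  rcases ht with ht | ht
  · rcases eq_zero_or_pos t with rfl | hpos
    · simp at ht
      exact absurd rfl ht.ne
    · obtain ⟨l, hl⟩ := hl t hpos
      exact key _ l ht hl
  · exact key _ (w t) ht (hw t)

lemma neBot_comap_inf_principal {w : ℝ≥0 → S} {u : ℝ≥0} {F : Filter ℝ}
    (h : ∀ V ∈ F, ∃ t ≤ u, (w t : ℝ) ∈ V) :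
    (comap (fun t => (w t : ℝ)) F ⊓ 𝓟 (Iic u)).NeBot := by
  rw [inf_principal_neBot_iff]
  rintro V ⟨W, hW, hWV⟩
  obtain ⟨t, htu, ht⟩ := h W hW
  exact ⟨t, hWV ht, htu⟩

lemma image_nonempty (w : ℝ≥0 → S) (u : ℝ≥0) : ((fun t => (w t : ℝ)) '' Iic u).Nonempty :=
  ⟨_, mem_image_of_mem _ (mem_Iic.2 le_rfl)⟩

lemma bddAbove_of_cadlag {w : ℝ≥0 → S} (hw : ∀ t, ContinuousWithinAt w (Ici t) t)
    (hl : ∀ t : ℝ≥0, 0 < t → ∃ l : S, Tendsto w (𝓝[<] t) (𝓝 l)) (u : ℝ≥0) :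
    BddAbove ((fun t => (w t : ℝ)) '' Iic u) := by
  by_contra h
  obtain ⟨l, hl⟩ := exists_mem_neBot_of_cadlag (u := u) (F := atTop) hw hl
    (neBot_comap_inf_principal fun V hV => by
      obtain ⟨c, hc⟩ := mem_atTop_sets.1 hV
      obtain ⟨_, ⟨t, ht, rfl⟩, hct⟩ := not_bddAbove_iff.1 h c
      exact ⟨t, ht, hc _ hct.le⟩)
  exact hl.ne (disjoint_nhds_atTop (l : ℝ)).symm.eq_bot

lemma bddBelow_of_cadlag {w : ℝ≥0 → S} (hw : ∀ t, ContinuousWithinAt w (Ici t) t)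
    (hl : ∀ t : ℝ≥0, 0 < t → ∃ l : S, Tendsto w (𝓝[<] t) (𝓝 l)) (u : ℝ≥0) :
    BddBelow ((fun t => (w t : ℝ)) '' Iic u) := by
  by_contra h
  obtain ⟨l, hl⟩ := exists_mem_neBot_of_cadlag (u := u) (F := atBot) hw hl
    (neBot_comap_inf_principal fun V hV => by
      obtain ⟨c, hc⟩ := mem_atBot_sets.1 hV
      obtain ⟨_, ⟨t, ht, rfl⟩, hct⟩ := not_bddBelow_iff.1 h c
      exact ⟨t, ht, hc _ hct.le⟩)
  exact hl.ne (disjoint_nhds_atBot (l : ℝ)).symm.eq_bot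

/-- The closure in `ℝ` of the range of a càdlàg path over a compact interval consists of values and
left limits of the path, so that it stays inside `S`. -/
lemma mem_of_mem_closure_of_cadlag {w : ℝ≥0 → S} (hw : ∀ t, ContinuousWithinAt w (Ici t) t)
    (hl : ∀ t : ℝ≥0, 0 < t → ∃ l : S, Tendsto w (𝓝[<] t) (𝓝 l)) {u : ℝ≥0} {y : ℝ}
    (hy : y ∈ closure ((fun t => (w t : ℝ)) '' Iic u)) : y ∈ S := by
  obtain ⟨l, hl⟩ := exists_mem_neBot_of_cadlag (u := u) (F := 𝓝 y) hw hl
    (neBot_comap_inf_principal fun V hV => by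
      obtain ⟨_, hzV, t, ht, rfl⟩ := mem_closure_iff_nhds.1 hy V hV
      exact ⟨t, ht, hzV⟩)
  exact eq_of_nhds_neBot hl ▸ l.2

end

section

variable {S : Set ℝ} {Ω : Type*}

/-! ### Measurability along right-continuous processes -/

lemma measurable_uncurry_of_rightCont [MeasurableSpace Ω] {X : ℝ≥0 → Ω → S}
    (hm : ∀ t, Measurable (X t))
    (hrc : ∀ ω t, ContinuousWithinAt (fun s => X s ω) (Ici t) t) :
    Measurable fun p : ℝ≥0 × Ω => X p.1 p.2 := by
  -- Times are approximated from the right on the grid of mesh `1 / (n + 1)`.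
  let g : ℕ → ℝ≥0 → ℕ := fun n t => ⌊t * (n + 1)⌋₊ + 1
  have hg : ∀ n, Measurable (g n) := fun n =>
    (Nat.measurable_floor.comp (measurable_id.mul_const _)).add_const 1
  refine measurable_of_tendsto_metrizable
    (f := fun (n : ℕ) (p : ℝ≥0 × Ω) => X ((g n p.1 : ℝ≥0) / (n + 1)) p.2) (fun n => ?_) ?_
  · have h1 : Measurable fun q : ℕ × Ω => X ((q.1 : ℝ≥0) / (n + 1)) q.2 :=
      measurable_from_prod_countable_right fun k => hm ((k : ℝ≥0) / (n + 1))
    have h2 : Measurable fun p : ℝ≥0 × Ω => (g n p.1, p.2) :=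
      ((hg n).comp measurable_fst).prodMk measurable_snd
    exact h1.comp h2
  · rw [tendsto_pi_nhds]
    rintro ⟨t, ω⟩
    have hpos : ∀ n : ℕ, (0 : ℝ≥0) < n + 1 := fun n => by positivity
    have hge : ∀ n : ℕ, t ≤ (g n t : ℝ≥0) / (n + 1) := fun n => by
      rw [le_div_iff₀ (hpos n)]
      simpa [g] using (Nat.lt_floor_add_one (t * ((n : ℝ≥0) + 1))).le
    have hle : ∀ n : ℕ, (g n t : ℝ≥0) / (n + 1) ≤ t + 1 / (n + 1) := fun n => by
      rw [div_le_iff₀ (hpos n), add_mul, one_div_mul_cancel (hpos n).ne']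
      simpa [g] using Nat.floor_le (a := t * ((n : ℝ≥0) + 1)) zero_le
    have hlim : Tendsto (fun n : ℕ => (g n t : ℝ≥0) / (n + 1)) atTop (𝓝[≥] t) := by
      refine tendsto_nhdsWithin_iff.2 ⟨?_, Eventually.of_forall hge⟩
      refine tendsto_of_tendsto_of_tendsto_of_le_of_le tendsto_const_nhds ?_ hge hle
      simpa using (tendsto_one_div_add_atTop_nhds_zero_nat (𝕜 := ℝ≥0)).const_add t
    exact (hrc ω t).tendsto.comp hlim

lemma measurable_posAt [MeasurableSpace Ω] {X : ℝ≥0 → Ω → S} (hm : ∀ t, Measurable (X t))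
    (hrc : ∀ ω t, ContinuousWithinAt (fun s => X s ω) (Ici t) t) {τ : Ω → ℝ≥0∞}
    (hτ : Measurable τ) : Measurable (posAt X τ) := by
  have h : Measurable fun ω => ((τ ω).toNNReal, ω) :=
    (ENNReal.measurable_toNNReal.comp hτ).prodMk measurable_id
  exact (measurable_uncurry_of_rightCont hm hrc).comp h

lemma measurable_of_coe_Iic [MeasurableSpace Ω] {τ : Ω → ℝ≥0∞}
    (h : ∀ c : ℝ≥0, MeasurableSet {ω | τ ω ≤ c}) : Measurable τ := by
  refine measurable_of_Iic fun c => ?_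
  rcases eq_or_ne c ⊤ with rfl | hc
  · rw [Iic_top, preimage_univ]
    exact MeasurableSet.univ
  · lift c to ℝ≥0 using hc
    exact h c

lemma measurable_rawFiltration (X : ℝ≥0 → Ω → S) {s t : ℝ≥0} (hst : s ≤ t) :
    Measurable[rawFiltration X t] (X s) := by
  rw [measurable_iff_comap_le]
  exact le_iSup₂ (f := fun s (_ : s ∈ Iic t) => MeasurableSpace.comap (X s) inferInstance) s hst

lemma measurable_rawSigma (X : ℝ≥0 → Ω → S) (s : ℝ≥0) : Measurable[rawSigma X] (X s) := by
  rw [measurable_iff_comap_le]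
  exact le_iSup (fun s => MeasurableSpace.comap (X s) inferInstance) s

lemma rawFiltration_le_rawSigma (X : ℝ≥0 → Ω → S) (t : ℝ≥0) : rawFiltration X t ≤ rawSigma X :=
  iSup₂_le fun s _ => le_iSup (fun s => MeasurableSpace.comap (X s) inferInstance) s

lemma measurableSet_iInf_rawFiltration {X : ℝ≥0 → Ω → S} {t : ℝ≥0} {A : Set Ω} :
    MeasurableSet[⨅ s ∈ Ioi t, rawFiltration X s] A ↔
      ∀ s, t < s → MeasurableSet[rawFiltration X s] A := by
  simp [MeasurableSpace.measurableSet_iInf]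

lemma measurableSet_rawSigma_of_iInf {X : ℝ≥0 → Ω → S} {t : ℝ≥0} {A : Set Ω}
    (h : MeasurableSet[⨅ s ∈ Ioi t, rawFiltration X s] A) : MeasurableSet[rawSigma X] A :=
  rawFiltration_le_rawSigma X _ _
    (measurableSet_iInf_rawFiltration.1 h (t + 1) (lt_add_one t))

lemma rawSigma_le [m : MeasurableSpace Ω] {X : ℝ≥0 → Ω → S} (hm : ∀ t, Measurable[m] (X t)) :
    rawSigma X ≤ m :=
  iSup_le fun t => (hm t).comap_le

/-! ### Stopping times -/

section HittingTimes

variable {X : ℝ≥0 → Ω → S}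

/-- The first time at which the process is in `E`. -/
noncomputable def hitTime (X : ℝ≥0 → Ω → S) (E : Set S) (ω : Ω) : ℝ≥0∞ :=
  ⨅ (t : ℝ≥0) (_ : X t ω ∈ E), (t : ℝ≥0∞)

lemma hitTime_le {E : Set S} {ω : Ω} {t : ℝ≥0} (h : X t ω ∈ E) : hitTime X E ω ≤ t :=
  iInf₂_le t h

lemma hitTime_lt_iff {E : Set S} {ω : Ω} {c : ℝ≥0∞} :
    hitTime X E ω < c ↔ ∃ t : ℝ≥0, X t ω ∈ E ∧ (t : ℝ≥0∞) < c := by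
  simp [hitTime, iInf_lt_iff]

lemma hitTime_anti {E E' : Set S} (h : E ⊆ E') (ω : Ω) : hitTime X E' ω ≤ hitTime X E ω :=
  le_iInf₂ fun _ ht => hitTime_le (h ht)

lemma hitTime_union (E E' : Set S) (ω : Ω) :
    hitTime X (E ∪ E') ω = min (hitTime X E ω) (hitTime X E' ω) := by
  refine le_antisymm (le_min (hitTime_anti subset_union_left ω)
    (hitTime_anti subset_union_right ω)) (le_iInf₂ fun t ht => ?_)
  rcases ht with ht | ht
  · exact (min_le_left _ _).trans (hitTime_le ht)
  · exact (min_le_right _ _).trans (hitTime_le ht)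

/-- By right-continuity, the position at a finite hitting time is in the closure of the target. -/
lemma posAt_hitTime_mem_closure (hrc : ∀ ω t, ContinuousWithinAt (fun s => X s ω) (Ici t) t)
    {E : Set S} {ω : Ω} (h : hitTime X E ω ≠ ⊤) : posAt X (hitTime X E) ω ∈ closure E := by
  rw [mem_closure_iff_nhds]
  intro V hV
  obtain ⟨v, hv, hvs⟩ := mem_nhdsGE_iff_exists_Ico_subset.1 ((hrc ω _) hV)
  have hlt : hitTime X E ω < v := by
    rw [← ENNReal.coe_toNNReal h]
    exact ENNReal.coe_lt_coe.2 hv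
  obtain ⟨t, htE, htv⟩ := hitTime_lt_iff.1 hlt
  refine ⟨X t ω, hvs ⟨?_, ENNReal.coe_lt_coe.1 htv⟩, htE⟩
  rw [← ENNReal.coe_le_coe, ENNReal.coe_toNNReal h]
  exact hitTime_le htE

lemma measurableSet_hitTime_le (hrc : ∀ ω t, ContinuousWithinAt (fun s => X s ω) (Ici t) t)
    {E : Set S} (hE : IsOpen E) (t : ℝ≥0) :
    MeasurableSet[⨅ s ∈ Ioi t, rawFiltration X s] {ω | hitTime X E ω ≤ t} := by
  rw [measurableSet_iInf_rawFiltration]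
  intro s hts
  have : {ω | hitTime X E ω ≤ t} = ⋂ (n : ℕ) (_ : t < denseTime n ∧ denseTime n < s),
      ⋃ (m : ℕ) (_ : denseTime m < denseTime n), X (denseTime m) ⁻¹' E := by
    ext ω
    simp only [mem_ofPred_eq, mem_iInter, mem_iUnion, mem_preimage, exists_prop]
    refine ⟨fun h n hn => ?_, fun h => ?_⟩
    · obtain ⟨r, hrE, hrn⟩ := hitTime_lt_iff.1 (h.trans_lt (ENNReal.coe_lt_coe.2 hn.1))
      obtain ⟨m, -, hm, hmE⟩ := exists_denseTime (ENNReal.coe_lt_coe.1 hrn)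
        ((hrc ω r).eventually (hE.mem_nhds hrE))
      exact ⟨m, hm, hmE⟩
    · by_contra! hlt
      obtain ⟨r, htr, hr⟩ := ENNReal.lt_iff_exists_nnreal_btwn.1 hlt
      obtain ⟨n, hn, hnr, -⟩ := exists_denseTime (p := fun _ => True)
        (lt_min (ENNReal.coe_lt_coe.1 htr) hts) (by simp)
      obtain ⟨m, hm, hmE⟩ := h n ⟨hn, hnr.trans_le (min_le_right _ _)⟩
      have h1 : hitTime X E ω ≤ denseTime m := hitTime_le hmE
      have h2 : (denseTime m : ℝ≥0∞) ≤ r :=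
        ENNReal.coe_le_coe.2 (hm.le.trans (hnr.le.trans (min_le_left _ _)))
      exact absurd (h1.trans h2) (not_le.2 hr)
  rw [this]
  refine MeasurableSet.iInter fun n => MeasurableSet.iInter fun hn =>
    MeasurableSet.iUnion fun m => MeasurableSet.iUnion fun hm => ?_
  exact measurable_rawFiltration X (hm.le.trans hn.2.le) hE.measurableSet

/-- The first of finitely many times `s ∈ F` at which `X_s ∈ C s`. -/
noncomputable def finiteHit (X : ℝ≥0 → Ω → S) (F : Finset ℝ≥0) (C : ℝ≥0 → Set S) (ω : Ω) : ℝ≥0∞ :=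
  ⨅ (s : ℝ≥0) (_ : s ∈ F ∧ X s ω ∈ C s), (s : ℝ≥0∞)

lemma finiteHit_le_iff {F : Finset ℝ≥0} {C : ℝ≥0 → Set S} {ω : Ω} {c : ℝ≥0∞} (hc : c ≠ ⊤) :
    finiteHit X F C ω ≤ c ↔ ∃ s ∈ F, X s ω ∈ C s ∧ (s : ℝ≥0∞) ≤ c := by
  refine ⟨fun h => ?_, fun ⟨s, hs, hsC, hsc⟩ => (iInf₂_le s ⟨hs, hsC⟩).trans hsc⟩
  by_contra! hlt
  have hfin : {s : ℝ≥0 | s ∈ F ∧ X s ω ∈ C s}.Finite :=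
    F.finite_toSet.subset fun s hs => hs.1
  have : c < finiteHit X F C ω := by
    rcases {s : ℝ≥0 | s ∈ F ∧ X s ω ∈ C s}.eq_empty_or_nonempty with he | hne
    · have he' : ∀ s, ¬ (s ∈ F ∧ X s ω ∈ C s) := fun s hs => (he ▸ hs : s ∈ (∅ : Set ℝ≥0))
      simpa [finiteHit, he'] using hc.lt_top
    · obtain ⟨s, hs, hmin⟩ := hfin.exists_minimal hne
      refine (hlt s hs.1 hs.2).trans_le (le_iInf₂ fun r hr => ?_)
      exact ENNReal.coe_le_coe.2 ((le_total s r).elim id fun h => hmin hr h)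
  exact absurd h (not_le.2 this)

end HittingTimes

section Stopping

variable [MeasurableSpace Ω] {X : ℝ≥0 → Ω → S} {P : S → Measure Ω}

lemma InFiltration.of_raw {t : ℝ≥0} {A : Set Ω}
    (h : MeasurableSet[⨅ s ∈ Ioi t, rawFiltration X s] A) : InFiltration X P t A :=
  fun _ _ => ⟨A, ∅, h, @MeasurableSet.empty _ (rawSigma X), by simp, by simp⟩

lemma InFiltration.mono {s t : ℝ≥0} (hst : s ≤ t) {A : Set Ω} (h : InFiltration X P s A) :
    InFiltration X P t A := fun μ hμ => by
  obtain ⟨B, N, hB, hN, hs, h0⟩ := h μ hμ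
  refine ⟨B, N, ?_, hN, hs, h0⟩
  rw [measurableSet_iInf_rawFiltration] at hB ⊢
  exact fun r hr => hB r (hst.trans_lt hr)

lemma InFiltration.union {t : ℝ≥0} {A A' : Set Ω} (h : InFiltration X P t A)
    (h' : InFiltration X P t A') : InFiltration X P t (A ∪ A') := fun μ hμ => by
  obtain ⟨B, N, hB, hN, hs, h0⟩ := h μ hμ
  obtain ⟨B', N', hB', hN', hs', h0'⟩ := h' μ hμ
  refine ⟨B ∪ B', N ∪ N', hB.union hB', hN.union hN', fun ω hω => ?_, ?_⟩
  · have h1 := @hs ω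
    have h2 := @hs' ω
    simp only [mem_symmDiff, mem_union] at h1 h2 hω ⊢
    tauto
  · filter_upwards [h0, h0'] with x hx hx'
    exact measure_union_null hx hx'

lemma IsStopping.inf {σ τ : Ω → ℝ≥0∞} (hσ : IsStopping X P σ) (hτ : IsStopping X P τ) :
    IsStopping X P fun ω => min (σ ω) (τ ω) := fun t => by
  have : {ω | min (σ ω) (τ ω) ≤ t} = {ω | σ ω ≤ t} ∪ {ω | τ ω ≤ t} := by
    ext ω; simp
  rw [this]
  exact (hσ t).union (hτ t)

lemma IsStopping.inPast {τ : Ω → ℝ≥0∞} (hτ : IsStopping X P τ) (s : ℝ≥0) :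
    InPast X P τ {ω | τ ω ≤ s} := fun t => by
  have : {ω | τ ω ≤ s} ∩ {ω | τ ω ≤ t} = {ω | τ ω ≤ ((min s t : ℝ≥0) : ℝ≥0∞)} := by
    ext ω; simp
  rw [this]
  exact (hτ _).mono (min_le_right _ _)

/-- Events of the augmented filtration are null measurable under every law `P_x`. -/
lemma InFiltration.nullMeasurableSet (hm : ∀ t, Measurable (X t)) {t : ℝ≥0} {A : Set Ω}
    (h : InFiltration X P t A) (x : S) : NullMeasurableSet A (P x) := by
  obtain ⟨B, N, hB, hN, hs, h0⟩ := h (Measure.dirac x) inferInstance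
  have h0 : P x N = 0 := by simpa [ae_dirac_eq] using h0
  have hB : MeasurableSet B := rawSigma_le hm _ (measurableSet_rawSigma_of_iInf hB)
  exact hB.nullMeasurableSet.congr
    (measure_symmDiff_eq_zero_iff.1 (measure_mono_null hs h0)).symm

lemma IsStopping.aemeasurable (hm : ∀ t, Measurable (X t)) {τ : Ω → ℝ≥0∞}
    (hτ : IsStopping X P τ) (x : S) : AEMeasurable τ (P x) := by
  refine NullMeasurable.aemeasurable (fun s hs => ?_)
  have : Measurable (α := NullMeasurableSpace Ω (P x)) τ :=
    measurable_of_coe_Iic (Ω := NullMeasurableSpace Ω (P x)) fun c =>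
      (hτ c).nullMeasurableSet hm x
  exact this hs

/-- The hitting time of an open set is a stopping time of the right-continuous filtration. -/
lemma isStopping_hitTime_of_isOpen
    (hrc : ∀ ω t, ContinuousWithinAt (fun s => X s ω) (Ici t) t) {E : Set S} (hE : IsOpen E) :
    IsStopping X P (hitTime X E) :=
  fun t => .of_raw (measurableSet_hitTime_le hrc hE t)

/-- The hitting time of a closed set `E` is almost surely the limit of the hitting times of the
neighbourhoods of `E`: by quasi-left-continuity the position at the limit is in `E`. The
exceptional set is what makes the augmentation of the filtration necessary. -/
lemma isStopping_hitTime_of_isClosed (hX : IsHuntProcess X P) {E : Set S} (hE : IsClosed E) :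
    IsStopping X P (hitTime X E) := by
  rcases E.eq_empty_or_nonempty with rfl | hne
  · exact isStopping_hitTime_of_isOpen hX.right_cont isOpen_empty
  let ε : ℕ → ℝ := fun n => 1 / (n + 1)
  have hε : ∀ n, 0 < ε n := fun n => by positivity
  have hεlim : Tendsto ε atTop (𝓝 0) := tendsto_one_div_add_atTop_nhds_zero_nat
  let E' : ℕ → Set S := fun n => Metric.thickening (ε n) E
  have hE' : ∀ n, IsOpen (E' n) := fun n => Metric.isOpen_thickening
  let σ : Ω → ℝ≥0∞ := fun ω => ⨆ n, hitTime X (E' n) ω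
  have hσle : ∀ ω, σ ω ≤ hitTime X E ω := fun ω =>
    iSup_le fun n => hitTime_anti (Metric.self_subset_thickening (hε n) E) ω
  have hσt : ∀ t : ℝ≥0, {ω | σ ω ≤ t} = ⋂ n, {ω | hitTime X (E' n) ω ≤ t} := fun t => by
    ext ω; simp [σ]
  have hσB : ∀ t : ℝ≥0, MeasurableSet[⨅ s ∈ Ioi t, rawFiltration X s] {ω | σ ω ≤ t} :=
    fun t => by
      rw [hσt]
      exact MeasurableSet.iInter fun n => measurableSet_hitTime_le hX.right_cont (hE' n) t
  have hσm : Measurable[rawSigma X] σ :=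
    @measurable_of_coe_Iic Ω (rawSigma X) σ fun c => measurableSet_rawSigma_of_iInf (hσB c)
  have hpos : Measurable[rawSigma X] (posAt X σ) :=
    @measurable_posAt S Ω (rawSigma X) X (measurable_rawSigma X) hX.right_cont σ hσm
  have hN0 : ∀ x, P x {ω | σ ω < ⊤ ∧ posAt X σ ω ∉ E} = 0 := fun x => by
    have hq := hX.quasi_left_cont (fun n => hitTime X (E' n))
      (fun n => isStopping_hitTime_of_isOpen hX.right_cont (hE' n))
      (fun ω => monotone_nat_of_le_succ fun n => hitTime_anti
        (Metric.thickening_mono (one_div_le_one_div_of_le (by positivity)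
          (by push_cast; linarith)) E) ω) x
    refine measure_mono_null ?_ hq
    rintro ω ⟨hfin, hnot⟩ hqω
    refine hnot ?_
    have hlim := hqω hfin
    have hin : ∀ n, Metric.infDist (posAt X (hitTime X (E' n)) ω) E ≤ ε n := fun n => by
      have hc := posAt_hitTime_mem_closure hX.right_cont (E := E' n) (ω := ω)
        ((le_iSup (fun n => hitTime X (E' n) ω) n).trans_lt hfin).ne
      have hsub : E' n ⊆ {y | Metric.infDist y E ≤ ε n} := fun y hy =>
        ((Metric.mem_thickening_iff_infDist_lt hne).1 hy).le
      exact closure_minimal hsub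
        (isClosed_le (Metric.continuous_infDist_pt E) continuous_const) hc
    have h0 : Metric.infDist (posAt X σ ω) E ≤ 0 :=
      le_of_tendsto_of_tendsto' (((Metric.continuous_infDist_pt E).tendsto _).comp hlim)
        hεlim hin
    exact (hE.mem_iff_infDist_zero hne).2 (le_antisymm h0 Metric.infDist_nonneg)
  intro t μ _
  refine ⟨{ω | σ ω ≤ t}, {ω | σ ω < ⊤ ∧ posAt X σ ω ∉ E}, hσB t, ?_, ?_, ?_⟩
  · exact (hσm measurableSet_Iio).inter (hpos hE.measurableSet.compl)
  · rintro ω (⟨h1, h2⟩ | ⟨h1, h2⟩)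
    · exact absurd ((hσle ω).trans h1) h2
    · have hfin : σ ω < ⊤ := lt_of_le_of_lt h1 ENNReal.coe_lt_top
      refine ⟨hfin, fun hE => h2 ?_⟩
      have := hitTime_le (X := X) hE
      rw [ENNReal.coe_toNNReal hfin.ne] at this
      exact this.trans h1
  · exact Eventually.of_forall hN0

lemma isStopping_finiteHit {F : Finset ℝ≥0} {C : ℝ≥0 → Set S}
    (hC : ∀ s, MeasurableSet (C s)) : IsStopping X P (finiteHit X F C) := fun t => by
  refine .of_raw (measurableSet_iInf_rawFiltration.2 fun r hr => ?_)
  have : {ω | finiteHit X F C ω ≤ t} = ⋃ s ∈ F, ⋃ (_ : s ≤ t), X s ⁻¹' C s := by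
    ext ω
    simp only [mem_ofPred_eq, finiteHit_le_iff ENNReal.coe_ne_top, mem_iUnion, mem_preimage,
      exists_prop, ENNReal.coe_le_coe]
    exact exists_congr fun s => and_congr_right fun _ => and_comm
  rw [this]
  exact Finset.measurableSet_biUnion _ fun s _ => MeasurableSet.iUnion fun hs =>
    measurable_rawFiltration X (hs.trans hr.le) (hC s)

end Stopping

end

section

variable {S : Set ℝ} {Ω : Type*} {X : ℝ≥0 → Ω → S}

/-! ### Functionals of the process up to an independent exponential time -/

lemma supBefore_le_supUpTo (f : S → ℝ) (T : Ω → ℝ≥0) (ω : Ω) :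
    supBefore f (fun t => X t ω) (T ω) ≤ supUpTo X T f ω :=
  supBefore_le fun t ht =>
    le_iSup₂ (f := fun t (_ : t ∈ Iic (T ω)) => ((f (X t ω) : ℝ) : EReal)) t ht.le

lemma supUpTo_le_supBefore {f : S → ℝ} (hf : LowerSemicontinuous f)
    (hrc : ∀ ω t, ContinuousWithinAt (fun s => X s ω) (Ici t) t) {T : Ω → ℝ≥0} {ω : Ω} {u : ℝ≥0}
    (hu : T ω < u) : supUpTo X T f ω ≤ supBefore f (fun t => X t ω) u :=
  iSup₂_le fun _ ht => le_supBefore hf (hrc ω) (lt_of_le_of_lt ht hu)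

variable [MeasurableSpace Ω] {P : S → Measure Ω}

lemma measurable_path (hm : ∀ t, Measurable (X t)) : Measurable fun ω t => X t ω :=
  measurable_pi_lambda _ hm

lemma IsIndepExpTime.map_eq {β : ℝ} {T : Ω → ℝ≥0} (hT : IsIndepExpTime X P β T) (x : S) :
    (P x).map T = expTime β := by
  have h : Measurable fun ω => (T ω : ℝ) := NNReal.continuous_coe.measurable.comp hT.measurable
  rw [expTime, ← hT.law x, Measure.map_map measurable_real_toNNReal h]
  congr 1
  ext ω
  simp

/-- Integration over the independent exponential horizon can be carried out pathwise. Whether the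
horizon itself is included in the supremum is almost surely irrelevant. -/
lemma lintegral_supUpTo (hX : IsHuntProcess X P) {β : ℝ} (hβ : 0 < β) {T : Ω → ℝ≥0}
    (hT : IsIndepExpTime X P β T) {f : S → ℝ} (hf : LowerSemicontinuous f) {ψ : EReal → ℝ≥0∞}
    (hψ : Measurable ψ) (x : S) :
    ∫⁻ ω, ψ (supUpTo X T f ω) ∂P x = ∫⁻ ω, expSup β f ψ (fun t => X t ω) ∂P x := by
  have := hX.prob x
  have := isProbabilityMeasure_expTime hβ
  have hp := measurable_path hX.measurable_pos
  have : IsProbabilityMeasure ((P x).map fun ω t => X t ω) :=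
    Measure.isProbabilityMeasure_map hp.aemeasurable
  have hlaw : (P x).map (fun ω => ((fun t => X t ω), T ω)) =
      ((P x).map fun ω t => X t ω).prod (expTime β) := by
    rw [← hT.map_eq x]
    exact (indepFun_iff_map_prod_eq_prod_map_map hp.aemeasurable
      hT.measurable.aemeasurable).1 (hT.indep x)
  have hpT : Measurable fun ω => ((fun t => X t ω), T ω) := hp.prodMk hT.measurable
  have hmeas : Measurable fun p : (ℝ≥0 → S) × ℝ≥0 => ψ (supBefore f p.1 p.2) :=
    hψ.comp (measurable_supBefore hf.measurable measurable_fst measurable_snd)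
  have hae : ∀ᵐ ω ∂P x, supBefore f (fun t => X t ω) (T ω) =
      ⨅ n : ℕ, supBefore f (fun t => X t ω) (T ω + 1 / (n + 1)) := by
    have h : ∀ᵐ p ∂(P x).map (fun ω => ((fun t => X t ω), T ω)),
        supBefore f p.1 p.2 = ⨅ n : ℕ, supBefore f p.1 (p.2 + 1 / (n + 1)) := by
      rw [hlaw, Measure.ae_prod_iff_ae_ae (measurableSet_supBefore_eq_iInf hf.measurable)]
      exact Eventually.of_forall fun w => ae_supBefore_eq_iInf β f w
    exact ae_of_ae_map hpT.aemeasurable h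
  calc ∫⁻ ω, ψ (supUpTo X T f ω) ∂P x
      = ∫⁻ ω, ψ (supBefore f (fun t => X t ω) (T ω)) ∂P x := by
        refine lintegral_congr_ae ?_
        filter_upwards [hae] with ω hω
        congr 1
        refine le_antisymm (hω ▸ le_iInf fun n => ?_) (supBefore_le_supUpTo f T ω)
        exact supUpTo_le_supBefore hf hX.right_cont (lt_add_of_pos_right _ (by positivity))
    _ = ∫⁻ p, ψ (supBefore f p.1 p.2) ∂((P x).map fun ω t => X t ω).prod (expTime β) := by
        rw [← hlaw, lintegral_map hmeas hpT]
    _ = ∫⁻ w, expSup β f ψ w ∂(P x).map fun ω t => X t ω :=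
        lintegral_prod _ hmeas.aemeasurable
    _ = _ := lintegral_map (measurable_expSup hβ hf.measurable hψ) hp

/-! ### The strong Markov property for functionals -/

/-- The laws of the paths, as a kernel from starting points to path space. -/
noncomputable def pathKernel (hX : IsHuntProcess X P) : Kernel S (ℝ≥0 → S) where
  toFun y := (P y).map fun ω t => X t ω
  measurable' := Measure.measurable_of_measurable_coe _ fun B hB => by
    simp_rw [Measure.map_apply (measurable_path hX.measurable_pos) hB]
    exact hX.measurable_law B hB

lemma lintegral_pathKernel (hX : IsHuntProcess X P) {H : (ℝ≥0 → S) → ℝ≥0∞} (hH : Measurable H)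
    (y : S) : ∫⁻ w, H w ∂pathKernel hX y = ∫⁻ ω, H (fun t => X t ω) ∂P y :=
  lintegral_map hH (measurable_path hX.measurable_pos)

lemma measurable_lintegral_path (hX : IsHuntProcess X P) {H : (ℝ≥0 → S) → ℝ≥0∞}
    (hH : Measurable H) : Measurable fun y => ∫⁻ ω, H (fun t => X t ω) ∂P y := by
  simp_rw [← lintegral_pathKernel hX hH]
  exact hH.lintegral_kernel

lemma IsStopping.aemeasurable_shift (hX : IsHuntProcess X P) {τ : Ω → ℝ≥0∞}
    (hτ : IsStopping X P τ) (x : S) :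
    AEMeasurable (fun ω s => X ((τ ω).toNNReal + s) ω) (P x) := by
  obtain ⟨τ', hτ', he⟩ := hτ.aemeasurable hX.measurable_pos x
  refine ⟨fun ω s => X ((τ' ω).toNNReal + s) ω, measurable_pi_lambda _ fun s => ?_, ?_⟩
  · have h : Measurable fun ω => ((τ' ω).toNNReal + s, ω) :=
      ((ENNReal.measurable_toNNReal.comp hτ').add_const s).prodMk measurable_id
    exact (measurable_uncurry_of_rightCont hX.measurable_pos hX.right_cont).comp h
  · filter_upwards [he] with ω hω
    rw [hω]

lemma IsStopping.aemeasurable_posAt (hX : IsHuntProcess X P) {τ : Ω → ℝ≥0∞}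
    (hτ : IsStopping X P τ) (x : S) : AEMeasurable (posAt X τ) (P x) := by
  have h := (measurable_pi_apply (X := fun _ : ℝ≥0 => S) 0).comp_aemeasurable
    (hτ.aemeasurable_shift hX x)
  refine h.congr (Eventually.of_forall fun ω => ?_)
  simp [posAt]

/-- The strong Markov property for nonnegative functionals, on the event `{τ ≤ s}`. -/
lemma setLIntegral_shift (hX : IsHuntProcess X P) {τ : Ω → ℝ≥0∞} (hτ : IsStopping X P τ)
    {H : (ℝ≥0 → S) → ℝ≥0∞} (hH : Measurable H) (x : S) (s : ℝ≥0) :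
    ∫⁻ ω in {ω | τ ω ≤ s}, H (fun r => X ((τ ω).toNNReal + r) ω) ∂P x =
      ∫⁻ ω in {ω | τ ω ≤ s}, ∫⁻ ω', H (fun r => X r ω') ∂P (posAt X τ ω) ∂P x := by
  set C := {ω | τ ω ≤ s} with hCdef
  have hC : NullMeasurableSet C (P x) := (hτ s).nullMeasurableSet hX.measurable_pos x
  have hCtop : {ω | ω ∈ C ∧ τ ω < ⊤} = C := by
    ext ω
    exact ⟨fun h => h.1, fun h => ⟨h, lt_of_le_of_lt h ENNReal.coe_lt_top⟩⟩
  have hsh := (hτ.aemeasurable_shift hX x).mono_measure (Measure.restrict_le_self (s := C))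
  have hpos := (hτ.aemeasurable_posAt hX x).mono_measure (Measure.restrict_le_self (s := C))
  have hker : Measurable (pathKernel hX) := (pathKernel hX).measurable
  have key : ((P x).restrict C).map (fun ω s => X ((τ ω).toNNReal + s) ω) =
      (((P x).restrict C).map (posAt X τ)).bind (pathKernel hX) := by
    refine Measure.ext fun B hB => ?_
    have hm := hX.strong_markov τ hτ C (hτ.inPast s) B hB x
    rw [hCtop] at hm
    rw [Measure.map_apply_of_aemeasurable hsh hB, Measure.restrict_apply₀' hC,
      Measure.bind_apply hB hker.aemeasurable,
      lintegral_map' ((pathKernel hX).measurable_coe hB).aemeasurable hpos]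
    calc _ = P x {ω | ω ∈ C ∧ τ ω < ⊤ ∧ (fun s => X ((τ ω).toNNReal + s) ω) ∈ B} := by
          congr 1
          ext ω
          constructor
          · exact fun h => ⟨h.2, lt_of_le_of_lt h.2 ENNReal.coe_lt_top, h.1⟩
          · exact fun h => ⟨h.2.2, h.1⟩
      _ = _ := hm
      _ = _ := by
          refine lintegral_congr fun ω => ?_
          exact (Measure.map_apply (measurable_path hX.measurable_pos) hB).symm
  rw [← lintegral_map' hH.aemeasurable hsh, key,
    Measure.lintegral_bind hker.aemeasurable hH.aemeasurable,
    lintegral_map' hH.lintegral_kernel.aemeasurable hpos]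
  exact lintegral_congr fun ω => lintegral_pathKernel hX hH _

/-- The strong Markov property with discounting: `E_x(e^{-βτ} H(X_{τ+·})) =
E_x(e^{-βτ} E_{X_τ} H(X))`, where the discount factor is written as an exponential tail. -/
lemma lintegral_discount_shift (hX : IsHuntProcess X P) {β : ℝ} (hβ : 0 < β) {τ : Ω → ℝ≥0∞}
    (hτ : IsStopping X P τ) {H : (ℝ≥0 → S) → ℝ≥0∞} (hH : Measurable H) (x : S) :
    ∫⁻ ω, expTime β {s | τ ω ≤ s} * H (fun r => X ((τ ω).toNNReal + r) ω) ∂P x =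
      ∫⁻ ω, expTime β {s | τ ω ≤ s} * ∫⁻ ω', H (fun r => X r ω') ∂P (posAt X τ ω) ∂P x := by
  have := hX.prob x
  have := isProbabilityMeasure_expTime hβ
  -- By Tonelli, the weight is an average of the indicators of the events `{τ ≤ s}`.
  have key : ∀ Y : Ω → ℝ≥0∞, AEMeasurable Y (P x) →
      ∫⁻ ω, expTime β {s | τ ω ≤ s} * Y ω ∂P x =
        ∫⁻ s, ∫⁻ ω in {ω | τ ω ≤ s}, Y ω ∂P x ∂expTime β := by
    intro Y hY
    have hset : ∀ ω, MeasurableSet {s : ℝ≥0 | τ ω ≤ s} := fun ω =>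
      measurableSet_le measurable_const measurable_coe_nnreal_ennreal
    have hns : NullMeasurableSet {p : Ω × ℝ≥0 | τ p.1 ≤ p.2} ((P x).prod (expTime β)) :=
      nullMeasurableSet_le ((hτ.aemeasurable hX.measurable_pos x).comp_fst)
        (measurable_coe_nnreal_ennreal.comp measurable_snd).aemeasurable
    calc _ = ∫⁻ ω, ∫⁻ s, {p : Ω × ℝ≥0 | τ p.1 ≤ p.2}.indicator (fun p => Y p.1) (ω, s)
          ∂expTime β ∂P x := by
          refine lintegral_congr fun ω => ?_
          have : (fun s => {p : Ω × ℝ≥0 | τ p.1 ≤ p.2}.indicator (fun p => Y p.1) (ω, s)) =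
              {s : ℝ≥0 | τ ω ≤ s}.indicator fun _ => Y ω := by
            ext s; simp [indicator]
          rw [this, lintegral_indicator_const (hset ω), mul_comm]
      _ = ∫⁻ s, ∫⁻ ω, {p : Ω × ℝ≥0 | τ p.1 ≤ p.2}.indicator (fun p => Y p.1) (ω, s)
          ∂P x ∂expTime β := lintegral_lintegral_swap (hY.comp_fst.indicator₀ hns)
      _ = _ := by
          refine lintegral_congr fun s => ?_
          rw [← lintegral_indicator₀ ((hτ s).nullMeasurableSet hX.measurable_pos x)]
          refine lintegral_congr fun ω => ?_
          simp [indicator]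
  rw [key (fun ω => H fun r => X ((τ ω).toNNReal + r) ω)
      (hH.comp_aemeasurable (hτ.aemeasurable_shift hX x)),
    key (fun ω => ∫⁻ ω', H (fun r => X r ω') ∂P (posAt X τ ω))
      ((measurable_lintegral_path hX hH).comp_aemeasurable (hτ.aemeasurable_posAt hX x))]
  exact lintegral_congr fun s => setLIntegral_shift hX hτ hH x s

end

section

variable {S : Set ℝ} {Ω : Type*} {X : ℝ≥0 → Ω → S}

/-! ### The exit time and the two bounds -/

lemma exitTime_eq_hitTime (J : Set S) : exitTime X J = hitTime X Jᶜ := rfl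

variable [MeasurableSpace Ω] {P : S → Measure Ω}

/-- The exit time from an interval, with or without its endpoints, is a stopping time: the process
leaves the interval on the left through an open or a closed half-line, and likewise on the right. -/
lemma isStopping_exitTime (hX : IsHuntProcess X P) {a b : S} {J : Set S} (hJ_ge : Ioo a b ⊆ J)
    (hJ_le : J ⊆ Icc a b) : IsStopping X P (exitTime X J) := by
  have hL : IsStopping X P (hitTime X (Iic a \ J)) := by
    by_cases ha : a ∈ J
    · have : Iic a \ J = Iio a := by
        ext y
        constructor
        · rintro ⟨h1, h2⟩
          exact lt_of_le_of_ne (mem_Iic.1 h1) fun e => h2 (by rwa [e])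
        · exact fun h => ⟨(mem_Iio.1 h).le, fun hy => absurd (hJ_le hy).1 (not_le.2 h)⟩
      rw [this]
      exact isStopping_hitTime_of_isOpen hX.right_cont isOpen_Iio
    · have : Iic a \ J = Iic a := by
        ext y
        refine ⟨fun h => h.1, fun h => ⟨h, fun hy => ha ?_⟩⟩
        rwa [le_antisymm (hJ_le hy).1 h]
      rw [this]
      exact isStopping_hitTime_of_isClosed hX isClosed_Iic
  have hR : IsStopping X P (hitTime X (Ici b \ J)) := by
    by_cases hb : b ∈ J
    · have : Ici b \ J = Ioi b := by
        ext y
        constructor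
        · rintro ⟨h1, h2⟩
          exact lt_of_le_of_ne (mem_Ici.1 h1) fun e => h2 (by rwa [← e])
        · exact fun h => ⟨(mem_Ioi.1 h).le, fun hy => absurd (hJ_le hy).2 (not_le.2 h)⟩
      rw [this]
      exact isStopping_hitTime_of_isOpen hX.right_cont isOpen_Ioi
    · have : Ici b \ J = Ici b := by
        ext y
        refine ⟨fun h => h.1, fun h => ⟨h, fun hy => hb ?_⟩⟩
        rwa [le_antisymm h (hJ_le hy).2]
      rw [this]
      exact isStopping_hitTime_of_isClosed hX isClosed_Ici
  have hU : Jᶜ = (Iic a \ J) ∪ (Ici b \ J) := by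
    ext y
    refine ⟨fun hy => ?_, fun h => h.elim (fun h => h.2) fun h => h.2⟩
    rcases le_or_gt y a with h | h
    · exact Or.inl ⟨h, hy⟩
    · exact Or.inr ⟨not_lt.1 fun hb => hy (hJ_ge ⟨h, hb⟩), hy⟩
  have : exitTime X J = fun ω => min (hitTime X (Iic a \ J) ω) (hitTime X (Ici b \ J) ω) := by
    ext ω
    rw [exitTime_eq_hitTime, hU, hitTime_union]
  rw [this]
  exact hL.inf hR

/-- The discounted value of `E_y (sup_{t < T} f(X_t))⁺` at a stopping time `τ ≥ n` is the expected
supremum after `τ` on the event `{τ ≤ T}`, hence at most the full supremum on `{n ≤ T}`. -/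
lemma lintegral_discount_expSup_le (hX : IsHuntProcess X P) {β : ℝ} (hβ : 0 < β) {f : S → ℝ}
    (hf : LowerSemicontinuous f) {τ : Ω → ℝ≥0∞} (hτ : IsStopping X P τ) {n : ℝ≥0}
    (hn : ∀ ω, n ≤ τ ω) (x : S) :
    ∫⁻ ω, expTime β {s | τ ω ≤ s} *
        ∫⁻ ω', expSup β f EReal.toENNReal (fun r => X r ω') ∂P (posAt X τ ω) ∂P x ≤
      ∫⁻ ω, ∫⁻ u in Ici n, (supBefore f (fun r => X r ω) u).toENNReal ∂expTime β ∂P x := by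
  rw [← lintegral_discount_shift hX hβ hτ
    (measurable_expSup hβ hf.measurable measurable_ereal_toENNReal)]
  refine lintegral_mono fun ω => ?_
  by_cases ht : τ ω = ⊤
  · simp [ht]
  obtain ⟨t, htω⟩ : ∃ t : ℝ≥0, (t : ℝ≥0∞) = τ ω := ⟨_, ENNReal.coe_toNNReal ht⟩
  have hnt : n ≤ t := ENNReal.coe_le_coe.1 (htω ▸ hn ω)
  simp only [expTime_tail hβ, ← htω, ENNReal.coe_ne_top, if_false, ENNReal.coe_toReal,
    ENNReal.toNNReal_coe]
  rw [ofReal_exp_mul_expSup_shift hf.measurable measurable_ereal_toENNReal (fun r => X r ω) t]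
  refine (setLIntegral_mono' measurableSet_Ici fun u hu => ?_).trans
    (lintegral_mono_set (Ici_subset_Ici.2 hnt))
  refine EReal.toENNReal_le_toENNReal (supBefore_le fun r hr => ?_)
  exact le_supBefore (w := fun r => X r ω) hf (hX.right_cont ω) (lt_tsub_iff_left.1 hr)

/-- Up to the exit time `f(X)` is nonpositive, so stopping there loses nothing of the supremum. -/
lemma lintegral_expSup_le_exitTime (hX : IsHuntProcess X P) {β : ℝ} (hβ : 0 < β) {f : S → ℝ}
    (hf : LowerSemicontinuous f) {J : Set S} (hf_in : ∀ x ∈ J, f x ≤ 0)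
    (hτ : IsStopping X P (exitTime X J)) (x : S) :
    ∫⁻ ω, expSup β f EReal.toENNReal (fun r => X r ω) ∂P x ≤
      ∫⁻ ω, expTime β {s | exitTime X J ω ≤ s} * ∫⁻ ω', expSup β f EReal.toENNReal
        (fun r => X r ω') ∂P (posAt X (exitTime X J) ω) ∂P x := by
  rw [← lintegral_discount_shift hX hβ hτ
    (measurable_expSup hβ hf.measurable measurable_ereal_toENNReal)]
  refine lintegral_mono fun ω => ?_
  have hbefore : ∀ r : ℝ≥0, (r : ℝ≥0∞) < exitTime X J ω → ((f (X r ω) : ℝ) : EReal) ≤ 0 :=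
    fun r hr => by
      refine EReal.coe_nonpos.2 (hf_in _ ?_)
      by_contra h
      exact absurd (iInf₂_le r h) (not_le.2 hr)
  by_cases ht : exitTime X J ω = ⊤
  · have : expSup β f EReal.toENNReal (fun r => X r ω) = 0 := by
      refine (lintegral_congr fun u => ?_).trans lintegral_zero
      exact EReal.toENNReal_of_nonpos (supBefore_le fun r _ => hbefore r (by simp [ht]))
    simp [this]
  obtain ⟨t, htω⟩ : ∃ t : ℝ≥0, (t : ℝ≥0∞) = exitTime X J ω := ⟨_, ENNReal.coe_toNNReal ht⟩
  simp only [expTime_tail hβ, ← htω, ENNReal.coe_ne_top, if_false, ENNReal.coe_toReal,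
    ENNReal.toNNReal_coe]
  rw [ofReal_exp_mul_expSup_shift hf.measurable measurable_ereal_toENNReal (fun r => X r ω) t,
    ← lintegral_indicator measurableSet_Ici, expSup]
  refine lintegral_mono fun u => ?_
  rcases lt_or_ge u t with hu | hu
  · rw [EReal.toENNReal_of_nonpos]
    · exact zero_le
    · exact supBefore_le fun r hr => hbefore r (htω ▸ ENNReal.coe_lt_coe.2 (hr.trans hu))
  · rw [indicator_of_mem (mem_Ici.2 hu)]
    have hle : supBefore f (fun r => X r ω) u ≤
        max (supBefore f (fun s => X (t + s) ω) (u - t)) 0 := supBefore_le fun r hr => by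
      rcases lt_or_ge r t with hrt | hrt
      · exact (hbefore r (htω ▸ ENNReal.coe_lt_coe.2 hrt)).trans (le_max_right _ _)
      · refine le_trans ?_ (le_max_left _ _)
        have h := le_supBefore hf (continuousWithinAt_shift (hX.right_cont ω) t)
          ((tsub_lt_tsub_iff_right hrt).2 hr)
        simpa [add_tsub_cancel_of_le hrt] using h
    refine (EReal.toENNReal_le_toENNReal hle).trans ?_
    rcases le_total (supBefore f (fun s => X (t + s) ω) (u - t)) 0 with h | h
    · simp [max_eq_right h]
    · rw [max_eq_left h]

/-- Immediately after the exit time the process visits the set where `f ≥ 0`, so the negative part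
of the supremum after that time vanishes. -/
lemma lintegral_discount_expSup_neg_exitTime (hX : IsHuntProcess X P) {β : ℝ} (hβ : 0 < β)
    {f : S → ℝ} (hf : LowerSemicontinuous f) {J : Set S} (hf_out : ∀ x ∉ J, 0 ≤ f x)
    (hτ : IsStopping X P (exitTime X J)) (x : S) :
    ∫⁻ ω, expTime β {s | exitTime X J ω ≤ s} * ∫⁻ ω', expSup β f (fun z => (-z).toENNReal)
        (fun r => X r ω') ∂P (posAt X (exitTime X J) ω) ∂P x = 0 := by
  have := nullSingletonClass_expTime β
  rw [← lintegral_discount_shift hX hβ hτ (measurable_expSup hβ hf.measurable (by fun_prop))]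
  refine (lintegral_congr fun ω => ?_).trans lintegral_zero
  by_cases ht : exitTime X J ω = ⊤
  · simp [ht]
  obtain ⟨t, htω⟩ : ∃ t : ℝ≥0, (t : ℝ≥0∞) = exitTime X J ω := ⟨_, ENNReal.coe_toNNReal ht⟩
  rw [← htω, ENNReal.toNNReal_coe]
  refine mul_eq_zero_of_right _ ((lintegral_congr_ae ?_).trans lintegral_zero)
  have h0 : ∀ᵐ v ∂expTime β, v ≠ 0 := by simp [ae_iff]
  filter_upwards [h0] with v hv
  have hlt : exitTime X J ω < (t + v : ℝ≥0) := by
    rw [← htω]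
    exact ENNReal.coe_lt_coe.2 (lt_add_of_pos_right t (pos_iff_ne_zero.2 hv))
  rw [exitTime_eq_hitTime] at hlt
  obtain ⟨r, hrJ, hr⟩ := hitTime_lt_iff.1 hlt
  have htr : t ≤ r := ENNReal.coe_le_coe.1 (htω ▸ iInf₂_le r hrJ)
  have hrv : r - t < v := (tsub_lt_iff_left htr).2 (ENNReal.coe_lt_coe.1 hr)
  have h := le_supBefore hf (continuousWithinAt_shift (hX.right_cont ω) t) hrv
  rw [add_tsub_cancel_of_le htr] at h
  refine EReal.toENNReal_of_nonpos (EReal.neg_le_zero.2 (le_trans ?_ h))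
  exact EReal.coe_nonneg.2 (hf_out _ hrJ)

/-! ### The reward of never stopping -/

/-- A maximal inequality: the probability that the discounted reward exceeds `c` after time `n` is
controlled by stopping at the first such time in a finite set, and letting the set grow. -/
lemma mul_measure_exists_le (hX : IsHuntProcess X P) {β : ℝ} (hβ : 0 < β) {f G : S → ℝ}
    (hf : LowerSemicontinuous f) (hG : LowerSemicontinuous G)
    (hGU : ∀ y, ENNReal.ofReal (G y) ≤
      ∫⁻ ω, expSup β f EReal.toENNReal (fun r => X r ω) ∂P y) (c : ℝ)
    (n : ℝ≥0) (x : S) :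
    ENNReal.ofReal c * P x {ω | ∃ t, n ≤ t ∧ c * Real.exp (β * t) < G (X t ω)} ≤
      ∫⁻ ω, ∫⁻ u in Ici n, (supBefore f (fun r => X r ω) u).toENNReal ∂expTime β ∂P x := by
  classical
  let C : ℝ≥0 → Set S := fun s => {y | c * Real.exp (β * s) < G y}
  have hC : ∀ s, MeasurableSet (C s) := fun s => measurableSet_lt measurable_const hG.measurable
  let F : ℕ → Finset ℝ≥0 := fun k => ((Finset.range k).image denseTime).filter (n ≤ ·)
  let A : ℕ → Set Ω := fun k => {ω | ∃ s ∈ F k, X s ω ∈ C s}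
  have hA : Monotone A := fun k l hkl ω ⟨s, hs, hsC⟩ =>
    ⟨s, Finset.filter_subset_filter _ (Finset.image_subset_image (Finset.range_mono hkl)) hs, hsC⟩
  have hsub : {ω | ∃ t, n ≤ t ∧ c * Real.exp (β * t) < G (X t ω)} ⊆ ⋃ k, A k := by
    rintro ω ⟨t, hnt, ht⟩
    obtain ⟨r, htr, hr⟩ := exists_between ht
    have h1 : ∀ᶠ s in 𝓝[≥] t, r < G (X s ω) := (hX.right_cont ω t).eventually (hG (X t ω) r hr)
    have h2 : ∀ᶠ s : ℝ≥0 in 𝓝[≥] t, c * Real.exp (β * s) < r :=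
      ((by fun_prop : Continuous fun s : ℝ≥0 => c * Real.exp (β * s)).continuousWithinAt).eventually
        (eventually_lt_nhds htr)
    obtain ⟨m, htm, -, hm1, hm2⟩ := exists_denseTime (lt_add_one t) (h1.and h2)
    refine mem_iUnion.2 ⟨m + 1, denseTime m, ?_, hm2.trans hm1⟩
    exact Finset.mem_filter.2 ⟨Finset.mem_image_of_mem _ (by simp), hnt.trans htm.le⟩
  have hbound : ∀ k, ENNReal.ofReal c * P x (A k) ≤
      ∫⁻ ω, ∫⁻ u in Ici n, (supBefore f (fun r => X r ω) u).toENNReal ∂expTime β ∂P x := by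
    intro k
    have hσ : IsStopping X P (finiteHit X (F k) C) := isStopping_finiteHit hC
    have hAm : MeasurableSet (A k) := by
      have : A k = ⋃ s ∈ F k, X s ⁻¹' C s := by ext ω; simp [A]
      rw [this]
      exact Finset.measurableSet_biUnion _ fun s _ => hX.measurable_pos s (hC s)
    refine le_trans ?_ (lintegral_discount_expSup_le hX hβ hf hσ
      (fun ω => le_iInf₂ fun s hs => ENNReal.coe_le_coe.2 (Finset.mem_filter.1 hs.1).2) x)
    rw [← lintegral_indicator_const hAm]
    refine lintegral_mono fun ω => ?_
    by_cases hω : ω ∈ A k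
    swap
    · simp [hω]
    rw [indicator_of_mem hω]
    obtain ⟨s₀, hs₀, hs₀C⟩ := hω
    have hfin : finiteHit X (F k) C ω ≠ ⊤ :=
      ((iInf₂_le s₀ ⟨hs₀, hs₀C⟩).trans_lt ENNReal.coe_lt_top).ne
    obtain ⟨s, hs, hsC, hsle⟩ := (finiteHit_le_iff hfin).1 le_rfl
    have he : finiteHit X (F k) C ω = s := le_antisymm (iInf₂_le s ⟨hs, hsC⟩) hsle
    refine le_trans ?_ (mul_le_mul_right (hGU _) _)
    rw [expTime_tail hβ, if_neg hfin, posAt, he, ENNReal.toNNReal_coe, ENNReal.coe_toReal,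
      ← ENNReal.ofReal_mul (Real.exp_pos _).le]
    refine ENNReal.ofReal_le_ofReal ?_
    calc c = Real.exp (-β * s) * (c * Real.exp (β * s)) := by
          rw [mul_left_comm, ← Real.exp_add]; simp
      _ ≤ _ := mul_le_mul_of_nonneg_left (le_of_lt hsC) (Real.exp_pos _).le
  calc _ ≤ ENNReal.ofReal c * P x (⋃ k, A k) := mul_le_mul_right (measure_mono hsub) _
    _ = ⨆ k, ENNReal.ofReal c * P x (A k) := by rw [hA.measure_iUnion, ENNReal.mul_iSup]
    _ ≤ _ := iSup_le hbound

/-- Never stopping earns nothing. -/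
lemma ae_limsup_reward_eq_zero (hX : IsHuntProcess X P) {β : ℝ} (hβ : 0 < β) {f G : S → ℝ}
    (hf : LowerSemicontinuous f) (hG : LowerSemicontinuous G)
    (hGU : ∀ y, ENNReal.ofReal (G y) ≤
      ∫⁻ ω, expSup β f EReal.toENNReal (fun r => X r ω) ∂P y) {x : S}
    (hfin : ∫⁻ ω, expSup β f EReal.toENNReal (fun r => X r ω) ∂P x ≠ ⊤) :
    ∀ᵐ ω ∂P x, limsup (fun t : ℝ≥0 =>
      ENNReal.ofReal (Real.exp (-β * t) * G (X t ω))) atTop = 0 := by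
  have := hX.prob x
  have := isProbabilityMeasure_expTime hβ
  have hjoint : Measurable fun p : Ω × ℝ≥0 =>
      (supBefore f (fun r => X r p.1) p.2).toENNReal :=
    (measurable_supBefore hf.measurable
      ((measurable_path hX.measurable_pos).comp measurable_fst) measurable_snd).ereal_toENNReal
  let g : ℝ≥0 → ℝ≥0∞ := fun u => ∫⁻ ω, (supBefore f (fun r => X r ω) u).toENNReal ∂P x
  have htail : Tendsto (fun n : ℕ => ∫⁻ ω, ∫⁻ u in Ici (n : ℝ≥0),
      (supBefore f (fun r => X r ω) u).toENNReal ∂expTime β ∂P x) atTop (𝓝 0) := by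
    have hswap : ∀ s : Set ℝ≥0, ∫⁻ ω, ∫⁻ u in s,
        (supBefore f (fun r => X r ω) u).toENNReal ∂expTime β ∂P x = ∫⁻ u in s, g u ∂expTime β :=
      fun s => lintegral_lintegral_swap hjoint.aemeasurable
    simp_rw [hswap]
    refine tendsto_setLIntegral_zero ?_ ?_
    · have h := hswap univ
      simp only [Measure.restrict_univ] at h
      rw [← h]
      exact hfin
    · have hIci : ∀ n : ℕ, expTime β (Ici (n : ℝ≥0)) =
          ENNReal.ofReal (Real.exp (-β * n)) := fun n => by
        have h := expTime_tail hβ ((n : ℝ≥0) : ℝ≥0∞)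
        rw [if_neg ENNReal.coe_ne_top, ENNReal.coe_toReal] at h
        simp only [ENNReal.coe_le_coe] at h
        exact h
      simp only [Function.comp_def, hIci]
      rw [← ENNReal.ofReal_zero]
      refine ENNReal.tendsto_ofReal (Real.tendsto_exp_atBot.comp ?_)
      exact tendsto_natCast_atTop_atTop.const_mul_atTop_of_neg (neg_lt_zero.2 hβ)
  have hnull : ∀ k : ℕ, P x {ω | ∀ n : ℕ, ∃ t : ℝ≥0, (n : ℝ≥0) ≤ t ∧
      1 / ((k : ℝ) + 1) * Real.exp (β * t) < G (X t ω)} = 0 := by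
    intro k
    have hc : (0 : ℝ) < 1 / ((k : ℝ) + 1) := by positivity
    have hsub : ∀ m : ℕ, {ω | ∀ n : ℕ, ∃ t : ℝ≥0, (n : ℝ≥0) ≤ t ∧
        1 / ((k : ℝ) + 1) * Real.exp (β * t) < G (X t ω)} ⊆ {ω | ∃ t, (m : ℝ≥0) ≤ t ∧
        1 / ((k : ℝ) + 1) * Real.exp (β * t) < G (X t ω)} := fun m ω hω => hω m
    have hle : ENNReal.ofReal (1 / ((k : ℝ) + 1)) * P x {ω | ∀ n : ℕ, ∃ t : ℝ≥0, (n : ℝ≥0) ≤ t ∧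
        1 / ((k : ℝ) + 1) * Real.exp (β * t) < G (X t ω)} ≤ 0 :=
      ge_of_tendsto' htail fun n => (mul_le_mul_right (measure_mono (hsub n)) _).trans
        (mul_measure_exists_le hX hβ hf hG hGU _ n x)
    exact (mul_eq_zero.1 (le_antisymm hle zero_le)).resolve_left (by simpa using hc)
  have hall : ∀ᵐ ω ∂P x, ∀ k : ℕ, ¬ ∀ n : ℕ, ∃ t : ℝ≥0, (n : ℝ≥0) ≤ t ∧
      1 / ((k : ℝ) + 1) * Real.exp (β * t) < G (X t ω) :=
    ae_all_iff.2 fun k => measure_eq_zero_iff_ae_notMem.1 (hnull k)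
  filter_upwards [hall] with ω hω
  by_contra hne
  obtain ⟨r, hr0, hr⟩ := ENNReal.lt_iff_exists_nnreal_btwn.1 (pos_iff_ne_zero.2 hne)
  obtain ⟨k, hk⟩ := exists_nat_one_div_lt (NNReal.coe_pos.2 (ENNReal.coe_pos.1 hr0))
  refine hω k fun n => ?_
  obtain ⟨t, hnt, ht⟩ :=
    (frequently_lt_of_lt_limsup (by isBoundedDefault) hr).forall_exists_of_atTop (n : ℝ≥0)
  refine ⟨t, hnt, ?_⟩
  have h1 : (r : ℝ) < Real.exp (-β * t) * G (X t ω) := by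
    rw [← ENNReal.ofReal_coe_nnreal] at ht
    exact (ENNReal.ofReal_lt_ofReal_iff_of_nonneg r.2).1 ht
  calc _ < Real.exp (-β * t) * G (X t ω) * Real.exp (β * t) :=
        mul_lt_mul_of_pos_right (hk.trans h1) (Real.exp_pos _)
    _ = G (X t ω) := by
        rw [mul_right_comm, ← Real.exp_add]; simp

end

section

variable {S : Set ℝ} {Ω : Type*} {X : ℝ≥0 → Ω → S}

/-! ### The supremum in terms of the running extrema -/

lemma le_supUpTo (T : Ω → ℝ≥0) (h : S → ℝ) {ω : Ω} {t : ℝ≥0} (ht : t ≤ T ω) :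
    ((h (X t ω) : ℝ) : EReal) ≤ supUpTo X T h ω :=
  le_iSup₂ (f := fun t (_ : t ∈ Iic (T ω)) => ((h (X t ω) : ℝ) : EReal)) t ht

lemma le_supUpTo_of_mem_closure {T : Ω → ℝ≥0} {f : S → ℝ} (hf : LowerSemicontinuous f) {ω : Ω}
    {y : S} (hy : (y : ℝ) ∈ closure ((fun t => (X t ω : ℝ)) '' Iic (T ω))) :
    ((f y : ℝ) : EReal) ≤ supUpTo X T f ω := by
  by_contra! hlt
  obtain ⟨r, hr, hry⟩ := EReal.lt_iff_exists_real_btwn.1 hlt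
  obtain ⟨V, hV, hVs⟩ := mem_nhds_subtype _ _ _ |>.1 (hf y r (EReal.coe_lt_coe_iff.1 hry))
  obtain ⟨_, hzV, t, ht, rfl⟩ := mem_closure_iff_nhds.1 hy V hV
  have hrt : r < f (X t ω) := hVs hzV
  exact absurd ((le_supUpTo T f ht).trans_lt hr) (not_lt.2 (EReal.coe_le_coe_iff.2 hrt.le))

lemma atReal_coe (f : S → ℝ) (y : S) : atReal f y = f y :=
  Subtype.val_injective.extend_apply f 0 y

lemma indicator_compl_eq_max {f : S → ℝ} {J : Set S} (hf_in : ∀ x ∈ J, f x ≤ 0)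
    (hf_out : ∀ x ∉ J, 0 ≤ f x) (y : S) : Jᶜ.indicator f y = max (f y) 0 := by
  by_cases hy : y ∈ J
  · simp [hy, hf_in y hy]
  · simp [hy, hf_out y hy]

lemma supUpTo_indicator {f : S → ℝ} {J : Set S} (hf_in : ∀ x ∈ J, f x ≤ 0)
    (hf_out : ∀ x ∉ J, 0 ≤ f x) (T : Ω → ℝ≥0) (ω : Ω) :
    supUpTo X T (Jᶜ.indicator f) ω = max (supUpTo X T f ω) 0 := by
  refine le_antisymm (iSup₂_le fun t ht => ?_) (max_le (iSup₂_le fun t ht => ?_) ?_)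
  · rw [indicator_compl_eq_max hf_in hf_out, EReal.coe_strictMono.monotone.map_max]
    exact max_le_max (le_supUpTo T f ht) le_rfl
  · refine le_trans (EReal.coe_le_coe_iff.2 ?_) (le_supUpTo T (Jᶜ.indicator f) ht)
    rw [indicator_compl_eq_max hf_in hf_out]
    exact le_max_left _ _
  · refine le_trans (EReal.coe_nonneg.2 ?_) (le_supUpTo T (Jᶜ.indicator f) zero_le)
    rw [indicator_compl_eq_max hf_in hf_out]
    exact le_max_right _ _

/-- By monotonicity of `f` outside `J`, no value of the process beats its running extrema; by lower
semicontinuity the values of `f` there are dominated by the supremum even if the extrema are not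
attained. -/
lemma max_supUpTo_eq {f : S → ℝ} {J : Set S} (hf_in : ∀ x ∈ J, f x ≤ 0)
    (hf : LowerSemicontinuous f) {a b : S} (hJ_ge : Ioo a b ⊆ J)
    (hJ_le : J ⊆ Icc a b) (hf_left : AntitoneOn f (Iic a \ J))
    (hf_right : MonotoneOn f (Ici b \ J)) {T : Ω → ℝ≥0} {ω : Ω}
    (hbelow : BddBelow ((fun t => (X t ω : ℝ)) '' Iic (T ω)))
    (habove : BddAbove ((fun t => (X t ω : ℝ)) '' Iic (T ω)))
    (hmin : runMin X T ω ∈ S) (hmax : runMax X T ω ∈ S) :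
    max (supUpTo X T f ω) 0 = ((max (twoSidedMax X T f a b ω) 0 : ℝ) : EReal) := by
  obtain ⟨i, hi⟩ : ∃ i : S, (i : ℝ) = runMin X T ω := ⟨⟨_, hmin⟩, rfl⟩
  obtain ⟨m, hm⟩ : ∃ m : S, (m : ℝ) = runMax X T ω := ⟨⟨_, hmax⟩, rfl⟩
  have hne : ((fun t => (X t ω : ℝ)) '' Iic (T ω)).Nonempty := image_nonempty (fun t => X t ω) _
  have hfi : ((f i : ℝ) : EReal) ≤ supUpTo X T f ω :=
    le_supUpTo_of_mem_closure hf (hi ▸ csInf_mem_closure hne hbelow)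
  have hfm : ((f m : ℝ) : EReal) ≤ supUpTo X T f ω :=
    le_supUpTo_of_mem_closure hf (hm ▸ csSup_mem_closure hne habove)
  have hiX : ∀ t ≤ T ω, i ≤ X t ω := fun t ht => by
    rw [← Subtype.coe_le_coe, hi]
    exact csInf_le hbelow (mem_image_of_mem _ ht)
  have hmX : ∀ t ≤ T ω, X t ω ≤ m := fun t ht => by
    rw [← Subtype.coe_le_coe, hm]
    exact le_csSup habove (mem_image_of_mem _ ht)
  rw [twoSidedMax, ← hi, ← hm, atReal_coe, atReal_coe]
  refine le_antisymm (max_le (iSup₂_le fun t ht => EReal.coe_le_coe_iff.2 ?_)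
    (EReal.coe_nonneg.2 (le_max_right _ _))) ?_
  · by_cases hJ : X t ω ∈ J
    · exact (hf_in _ hJ).trans (le_max_right _ _)
    refine le_trans ?_ (le_max_left _ _)
    rcases le_or_gt (X t ω) a with h | h
    · have hia := (hiX t ht).trans h
      refine le_trans ?_ (le_max_left _ _)
      rw [if_pos (Subtype.coe_le_coe.2 hia)]
      refine hf_left ⟨hia, fun hiJ => hJ ?_⟩ ⟨h, hJ⟩ (hiX t ht)
      rwa [le_antisymm (h.trans (hJ_le hiJ).1) (hiX t ht)]
    · have h : b ≤ X t ω := not_lt.1 fun hb => hJ (hJ_ge ⟨h, hb⟩)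
      have hbm := h.trans (hmX t ht)
      refine le_trans ?_ (le_max_right _ _)
      rw [if_pos (Subtype.coe_le_coe.2 hbm)]
      refine hf_right ⟨h, hJ⟩ ⟨hbm, fun hmJ => hJ ?_⟩ (hmX t ht)
      rwa [le_antisymm (hmX t ht) ((hJ_le hmJ).2.trans h)]
  · rw [EReal.coe_strictMono.monotone.map_max, EReal.coe_strictMono.monotone.map_max]
    refine max_le (max_le ?_ ?_) (le_max_right _ _)
    · split_ifs
      · exact hfi.trans (le_max_left _ _)
      · exact le_max_right _ _
    · split_ifs
      · exact hfm.trans (le_max_left _ _)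
      · exact le_max_right _ _

lemma twoSidedMax_nonneg {f : S → ℝ} {J : Set S} (hf_out : ∀ x ∉ J, 0 ≤ f x) {a b : S}
    (hJ_le : J ⊆ Icc a b) {T : Ω → ℝ≥0} {ω : Ω} (hmin : runMin X T ω ∈ S)
    (hmax : runMax X T ω ∈ S)
    (h : 0 ≤ f a ∨ 0 ≤ f b ∨ ¬ (runMin X T ω = a ∧ runMax X T ω = b)) :
    0 ≤ twoSidedMax X T f a b ω := by
  obtain ⟨i, hi⟩ : ∃ i : S, (i : ℝ) = runMin X T ω := ⟨⟨_, hmin⟩, rfl⟩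
  obtain ⟨m, hm⟩ : ∃ m : S, (m : ℝ) = runMax X T ω := ⟨⟨_, hmax⟩, rfl⟩
  rw [twoSidedMax, ← hi, ← hm, atReal_coe, atReal_coe]
  rw [← hi, ← hm, Subtype.coe_inj, Subtype.coe_inj] at h
  simp only [Subtype.coe_le_coe]
  -- The only way to be negative is to have both extrema in `J`, that is, at the thresholds.
  by_cases hia : i ≤ a
  swap
  · simp [hia]
  by_cases hbm : b ≤ m
  swap
  · simp [hbm]
  rw [if_pos hia, if_pos hbm, le_max_iff]
  by_cases hiJ : i ∈ J
  swap
  · exact Or.inl (hf_out i hiJ)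
  by_cases hmJ : m ∈ J
  swap
  · exact Or.inr (hf_out m hmJ)
  have hi' : i = a := le_antisymm hia (hJ_le hiJ).1
  have hm' : m = b := le_antisymm (hJ_le hmJ).2 hbm
  rw [hi', hm']
  tauto

/-! ### Expectations of extended real random variables -/

section Expect

variable [MeasurableSpace Ω]

lemma expect_eq_of_nonneg {μ : Measure Ω} {Y : Ω → EReal} (hY : ∀ᵐ ω ∂μ, 0 ≤ Y ω) :
    expect μ Y = ((∫⁻ ω, (Y ω).toENNReal ∂μ : ℝ≥0∞) : EReal) := by
  have : ∫⁻ ω, (-Y ω).toENNReal ∂μ = 0 := by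
    refine (lintegral_congr_ae ?_).trans lintegral_zero
    filter_upwards [hY] with ω hω
    exact EReal.toENNReal_of_nonpos (EReal.neg_le_zero.2 hω)
  simp [expect, this]

/-- An expectation that dominates a real number has a positive part at least as large. -/
lemma ofReal_le_of_le_expect {μ : Measure Ω} {Y : Ω → EReal} {c : ℝ}
    (h : (c : EReal) ≤ expect μ Y) : ENNReal.ofReal c ≤ ∫⁻ ω, (Y ω).toENNReal ∂μ := by
  have h1 : (c : EReal) ≤ ((∫⁻ ω, (Y ω).toENNReal ∂μ : ℝ≥0∞) : EReal) :=
    h.trans <| by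
      rw [expect, sub_eq_add_neg]
      exact add_le_of_nonpos_right (EReal.neg_le_zero.2 (EReal.coe_ennreal_nonneg _))
  simpa using EReal.toENNReal_le_toENNReal h1

/-- A real expectation is the difference of two finite parts. -/
lemma lintegral_eq_of_expect_eq {μ : Measure Ω} {Y : Ω → EReal} {c : ℝ} (hc : 0 ≤ c)
    (h : expect μ Y = c) : ∫⁻ ω, (Y ω).toENNReal ∂μ =
      ENNReal.ofReal c + ∫⁻ ω, (-Y ω).toENNReal ∂μ := by
  rw [expect] at h
  generalize ∫⁻ ω, (Y ω).toENNReal ∂μ = p at h ⊢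
  generalize ∫⁻ ω, (-Y ω).toENNReal ∂μ = q at h ⊢
  rcases eq_or_ne q ⊤ with rfl | hq
  · simp at h
  rcases eq_or_ne p ⊤ with rfl | hp
  · lift q to ℝ≥0 using hq
    simp at h
  lift p to ℝ≥0 using hp
  lift q to ℝ≥0 using hq
  have h' : (p : ℝ) - q = c := by
    rw [← EReal.coe_eq_coe_iff, EReal.coe_sub]
    exact h
  have : p = c.toNNReal + q := by
    rw [← NNReal.coe_inj, NNReal.coe_add, Real.coe_toNNReal _ hc]
    linarith
  rw [this, ENNReal.coe_add]
  rfl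

end Expect

/-! ### Identification of the value function -/

/-- A reward with vanishing limit at infinity is the discounted payoff at the stopping time, with
discount zero on `{τ = ∞}`. -/
lemma reward_eq {β : ℝ} (hβ : 0 < β) {G : S → ℝ} {τ : Ω → ℝ≥0∞} {ω : Ω}
    (h : limsup (fun t : ℝ≥0 => ENNReal.ofReal (Real.exp (-β * t) * G (X t ω))) atTop = 0) :
    reward X β G τ ω = expTime β {s | τ ω ≤ s} * ENNReal.ofReal (G (posAt X τ ω)) := by
  rw [reward, expTime_tail hβ]
  split_ifs with ht
  · rw [h, zero_mul]
  · rw [ENNReal.ofReal_mul (Real.exp_pos _).le]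

variable [MeasurableSpace Ω] {P : S → Measure Ω}

/-- The value function equals `U(x) = E_x (sup_{t < T} f(X_t))⁺`, and it is attained by leaving
`J`. -/
lemma value_eq_and_isOptimal (hX : IsHuntProcess X P) {β : ℝ} (hβ : 0 < β) {G : S → ℝ}
    (hG : LowerSemicontinuous G)
    (hG_int : ∀ x,
      ∫⁻ ω, ⨆ t : ℝ≥0, ENNReal.ofReal (Real.exp (-β * t) * G (X t ω)) ∂P x < ⊤)
    {f : S → ℝ} (hf : LowerSemicontinuous f) {a b : S} {J : Set S} (hJ_ge : Ioo a b ⊆ J)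
    (hJ_le : J ⊆ Icc a b) (hf_in : ∀ x ∈ J, f x ≤ 0) (hf_out : ∀ x ∉ J, 0 ≤ f x)
    (hGU : ∀ y, ENNReal.ofReal (G y) ≤
      ∫⁻ ω, expSup β f EReal.toENNReal (fun r => X r ω) ∂P y)
    (hGN : ∀ y ∉ Ioo a b, ∫⁻ ω, expSup β f EReal.toENNReal (fun r => X r ω) ∂P y =
      ENNReal.ofReal (G y) +
        ∫⁻ ω, expSup β f (fun z => (-z).toENNReal) (fun r => X r ω) ∂P y) :
    (∀ x, value X P β G x = ∫⁻ ω, expSup β f EReal.toENNReal (fun r => X r ω) ∂P x) ∧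
      IsOptimal X P β G (exitTime X J) := by
  have hτ : IsStopping X P (exitTime X J) := isStopping_exitTime hX hJ_ge hJ_le
  -- At the exit time the process is outside the open interval, where `G = U - N`, and the
  -- contribution of the negative part `N` vanishes.
  have hlow : ∀ x, ∫⁻ ω, expSup β f EReal.toENNReal (fun r => X r ω) ∂P x ≤
      ∫⁻ ω, expTime β {s | exitTime X J ω ≤ s} *
        ENNReal.ofReal (G (posAt X (exitTime X J) ω)) ∂P x := by
    intro x
    have hN := lintegral_discount_expSup_neg_exitTime hX hβ hf hf_out hτ x
    refine (lintegral_expSup_le_exitTime hX hβ hf hf_in hτ x).trans ?_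
    rw [← add_zero (∫⁻ ω, expTime β {s | exitTime X J ω ≤ s} *
      ENNReal.ofReal (G (posAt X (exitTime X J) ω)) ∂P x), ← hN, ← lintegral_add_left']
    · refine lintegral_mono fun ω => ?_
      by_cases ht : exitTime X J ω = ⊤
      · simp [ht]
      have hmem : posAt X (exitTime X J) ω ∉ Ioo a b := by
        have h := posAt_hitTime_mem_closure (E := Jᶜ) hX.right_cont ht
        exact closure_minimal (compl_subset_compl.2 hJ_ge) isOpen_Ioo.isClosed_compl h
      exact (by rw [hGN _ hmem, mul_add] : _ = _).le
    · have h1 : Measurable fun t : ℝ≥0∞ => expTime β {s | t ≤ (s : ℝ≥0∞)} := by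
        refine Antitone.measurable fun t t' h => measure_mono fun s hs => ?_
        exact h.trans hs
      exact (h1.comp_aemeasurable (hτ.aemeasurable hX.measurable_pos x)).mul
        (hG.measurable.ennreal_ofReal.comp_aemeasurable (hτ.aemeasurable_posAt hX x))
  have hfin : ∀ x, ∫⁻ ω, expSup β f EReal.toENNReal (fun r => X r ω) ∂P x ≠ ⊤ := by
    refine fun x => ((hlow x).trans_lt (lt_of_le_of_lt (lintegral_mono fun ω => ?_)
      (hG_int x))).ne
    rw [expTime_tail hβ]
    split_ifs with ht
    · simp
    · rw [← ENNReal.ofReal_mul (Real.exp_pos _).le]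
      exact le_iSup (fun t : ℝ≥0 => ENNReal.ofReal (Real.exp (-β * t) * G (X t ω)))
        (exitTime X J ω).toNNReal
  have hlim := fun x => ae_limsup_reward_eq_zero hX hβ hf hG hGU (hfin x)
  have hreward : ∀ τ x, ∫⁻ ω, reward X β G τ ω ∂P x =
      ∫⁻ ω, expTime β {s | τ ω ≤ s} * ENNReal.ofReal (G (posAt X τ ω)) ∂P x := fun τ x => by
    refine lintegral_congr_ae ?_
    filter_upwards [hlim x] with ω hω
    exact reward_eq hβ hω
  have hup : ∀ x, value X P β G x ≤
      ∫⁻ ω, expSup β f EReal.toENNReal (fun r => X r ω) ∂P x := by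
    refine fun x => iSup₂_le fun σ hσ => ?_
    rw [hreward]
    refine (lintegral_mono fun ω => mul_le_mul_right (hGU _) _).trans
      ((lintegral_discount_expSup_le hX hβ hf hσ (n := 0) (fun ω => by simp) x).trans ?_)
    exact lintegral_mono fun ω => setLIntegral_le_lintegral _ _
  have hopt : ∀ x, ∫⁻ ω, reward X β G (exitTime X J) ω ∂P x ≤ value X P β G x := fun x =>
    le_iSup₂ (f := fun (τ : Ω → ℝ≥0∞) (_ : IsStopping X P τ) => ∫⁻ ω, reward X β G τ ω ∂P x)
      (exitTime X J) hτ
  have hlow' : ∀ x, ∫⁻ ω, expSup β f EReal.toENNReal (fun r => X r ω) ∂P x ≤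
      ∫⁻ ω, reward X β G (exitTime X J) ω ∂P x := fun x => hreward (exitTime X J) x ▸ hlow x
  exact ⟨fun x => le_antisymm (hup x) ((hlow' x).trans (hopt x)), hτ,
    fun x => le_antisymm ((hup x).trans (hlow' x)) (hopt x)⟩

end

end HuntStop

theorem mainTheorem2 {S : Set ℝ} {Ω : Type*} [MeasurableSpace Ω]
    (X : ℝ≥0 → Ω → S) (P : S → Measure Ω) (hX : IsHuntProcess X P)
    (β : ℝ) (hβ : 0 < β) (T : Ω → ℝ≥0) (hT : IsIndepExpTime X P β T)
    (G : S → ℝ) (hG_nonneg : ∀ x, 0 ≤ G x) (hG_lsc : LowerSemicontinuous G)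
    (hG_int : ∀ x,
      ∫⁻ ω, ⨆ t : ℝ≥0, ENNReal.ofReal (Real.exp (-β * t) * G (X t ω)) ∂P x < ⊤)
    (f : S → ℝ) (hf_lsc : LowerSemicontinuous f)
    (a b : S) (hab : a ≤ b)
    (J : Set S) (hJ_ge : Ioo a b ⊆ J) (hJ_le : J ⊆ Icc a b)
    (hf_in : ∀ x ∈ J, f x ≤ 0)
    (hf_out : ∀ x ∉ J, 0 ≤ f x)
    (hf_left : AntitoneOn f (Iic a \ J))
    (hf_right : MonotoneOn f (Ici b \ J))
    (hfG_out : ∀ x ∉ Ioo a b, expect (P x) (supUpTo X T f) = (G x : EReal))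
    (hfG_in : ∀ x ∈ Ioo a b, (G x : EReal) ≤ expect (P x) (supUpTo X T f)) :
    (∀ x, (value X P β G x : EReal) = expect (P x) (supUpTo X T (Jᶜ.indicator f))) ∧
    (∀ x, ∀ᵐ ω ∂P x, runMin X T ω ∈ S ∧ runMax X T ω ∈ S) ∧
    (∀ x, (value X P β G x : EReal) =
      expect (P x) (fun ω => ((max (twoSidedMax X T f a b ω) 0 : ℝ) : EReal))) ∧
    (∀ x, (0 ≤ f a ∨ 0 ≤ f b ∨ P x {ω | runMin X T ω = a ∧ runMax X T ω = b} = 0) →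
      (value X P β G x : EReal) =
        expect (P x) (fun ω => (twoSidedMax X T f a b ω : EReal))) ∧
    IsOptimal X P β G (exitTime X J) := by
  have hpos := fun x => lintegral_supUpTo hX hβ hT hf_lsc measurable_ereal_toENNReal x
  have hneg := fun x => lintegral_supUpTo hX hβ hT hf_lsc
    (ψ := fun z => (-z).toENNReal) (by fun_prop) x
  obtain ⟨hval, hopt⟩ := value_eq_and_isOptimal hX hβ hG_lsc hG_int hf_lsc hJ_ge hJ_le hf_in hf_out
    (fun y => by
      rw [← hpos y]
      refine ofReal_le_of_le_expect ?_
      by_cases hy : y ∈ Ioo a b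
      · exact hfG_in y hy
      · exact (hfG_out y hy).ge)
    (fun y hy => by
      rw [← hpos y, ← hneg y]
      exact lintegral_eq_of_expect_eq (hG_nonneg y) (hfG_out y hy))
  -- All three representations are expectations of the positive part of the same supremum.
  have hrep : ∀ x (Y : Ω → EReal), (∀ᵐ ω ∂P x, Y ω = max (supUpTo X T f ω) 0) →
      (value X P β G x : EReal) = expect (P x) Y := by
    intro x Y hY
    rw [expect_eq_of_nonneg (hY.mono fun ω hω => hω ▸ le_max_right _ _), hval x, ← hpos x]
    congr 1
    refine lintegral_congr_ae ?_
    filter_upwards [hY] with ω hω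
    rw [hω]
    rcases le_total (supUpTo X T f ω) 0 with h | h
    · rw [max_eq_right h, EReal.toENNReal_of_nonpos h, EReal.toENNReal_zero]
    · rw [max_eq_left h]
  have hext : ∀ x, ∀ᵐ ω ∂P x, (runMin X T ω ∈ S ∧ runMax X T ω ∈ S) ∧
      max (supUpTo X T f ω) 0 = ((max (twoSidedMax X T f a b ω) 0 : ℝ) : EReal) := by
    intro x
    filter_upwards [hX.left_lim x] with ω hω
    have hne : ((fun t => (X t ω : ℝ)) '' Iic (T ω)).Nonempty :=
      image_nonempty (fun t => X t ω) _
    have hbelow := bddBelow_of_cadlag (hX.right_cont ω) hω (T ω)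
    have habove := bddAbove_of_cadlag (hX.right_cont ω) hω (T ω)
    have hmin : runMin X T ω ∈ S :=
      mem_of_mem_closure_of_cadlag (hX.right_cont ω) hω (csInf_mem_closure hne hbelow)
    have hmax : runMax X T ω ∈ S :=
      mem_of_mem_closure_of_cadlag (hX.right_cont ω) hω (csSup_mem_closure hne habove)
    exact ⟨⟨hmin, hmax⟩, max_supUpTo_eq hf_in hf_lsc hJ_ge hJ_le hf_left hf_right hbelow
      habove hmin hmax⟩
  refine ⟨fun x => hrep x _ (Eventually.of_forall (supUpTo_indicator hf_in hf_out T)),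
    fun x => (hext x).mono fun ω hω => hω.1,
    fun x => hrep x _ ((hext x).mono fun ω hω => hω.2.symm),
    fun x hx => hrep x _ ?_, hopt⟩
  have hcase : ∀ᵐ ω ∂P x, 0 ≤ f a ∨ 0 ≤ f b ∨ ¬ (runMin X T ω = a ∧ runMax X T ω = b) := by
    rcases hx with h | h | h
    · exact Eventually.of_forall fun _ => Or.inl h
    · exact Eventually.of_forall fun _ => Or.inr (Or.inl h)
    · exact (measure_eq_zero_iff_ae_notMem.1 h).mono fun ω hω => Or.inr (Or.inr hω)
  filter_upwards [hext x, hcase] with ω hω hω'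
  rw [hω.2, max_eq_left (twoSidedMax_nonneg hf_out hJ_le hω.1.1 hω.1.2 hω')]
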